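/- Let $\Omega\subset\mathbb R^3$ be a bounded open set, $\Omega_n\subset\Omega$ ($n\in\mathbb N$) measurable subsets, $\alpha_1,\alpha_2>0$, $\alpha_{2,n}\ge\alpha_1$, and let $$\alpha_n:=\mathbf 1_{\Omega\setminus\Omega_n}\,\alpha_1+\mathbf 1_{\Omega_n}\,\alpha_{2,n},\qquad \frac{|\Omega_n|}{|\Omega|}\,\alpha_{2,n}\xrightarrow[n\to\infty]{}\alpha_2 .$$ Let $\varepsilon_n>0$ with $\varepsilon_n\to0$ and, for $k\in\mathbb Z^3$, let $Q_n^k:=\varepsilon_n(Y+k)$ with $Y=(-\tfrac12,\tfrac12)^3$. Assume that there are constants $c_n>0$ with $c_n\to0$ and a constant $A$, independent of $n$ and $k$, such that for every $n$ and every $k$ with $Q_n^k\subset\Omega$: (i) $\displaystyle\int_{Q_n^k}\alpha_n\Big|w-\frac1{|Q_n^k|}\int_{Q_n^k}w\,dy\Big|^2dx\le c_n\int_{Q_n^k}\alpha_n|\nabla w|^2\,dx$ for all $w\in H^1(Q_n^k)$; (ii) $\displaystyle\frac1{|Q_n^k|}\int_{Q_n^k}\alpha_n\,dx\le A$. Write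 $\mathcal M(\Omega)$ for the finite signed Borel measures on $\Omega$, with weak-$*$ convergence tested against $C_0(\Omega)$, the continuous functions on $\overline\Omega$ that vanish on $\partial\Omega$. Let $\xi_n\in L^1(\Omega)$ converge weakly-$*$ in $\mathcal M(\Omega)$ to $\xi\in\mathcal M(\Omega)$, let $v_n\in H^1(\Omega)$ converge weakly in $H^1(\Omega)$ to $v$, and assume that, for some constant $B$ independent of $n$, $$\int_\Omega\alpha_n^{-1}|\xi_n|^2\,dx+\int_\Omega\alpha_n|\nabla v_n|^2\,dx\le B\qquad\text{for all }n .$$ Then $\xi\in L^2(\Omega)$ (that is, $\xi=g\,dx$ with $g\in L^2(\Omega)$), and $\xi_nv_n\to\xi v$ in $\mathcal D'(\Omega)$, i.e. $\int_\Omega\xi_nv_n\varphi\,dx\to\int_\Omega g\,v\,\varphi\,dx$ for every $\varphi\in C_c^\infty(\Omega)$. Moreover, $\alpha_n$ has a subsequence that converges weakly-$*$ in $\mathcal M(\Omega)$, and the weak-$*$ limit of every weakly-$*$ convergent subsequence of $\alpha_n$ is (the measure with density) a function in $L^\infty(\Omega)$. -/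

import Mathlib

open MeasureTheory Filter Topology Set
open scoped ENNReal ContDiff

namespace HighContrast

/-- Three-dimensional Euclidean space. -/
abbrev E3 : Type := EuclideanSpace ℝ (Fin 3)

/-- The open cell `ε (Y + k)`, where `Y = (-1/2, 1/2)³` and `k ∈ ℤ³`. -/
def cell (ε : ℝ) (k : Fin 3 → ℤ) : Set E3 :=
  {x | ∀ i, ε * ((k i : ℝ) - 1 / 2) < x i ∧ x i < ε * ((k i : ℝ) + 1 / 2)}

/-- The two-phase coefficient, equal to `a₁` on `Ω \ D` and to `a₂` on `D` (and to `0` outside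
`Ω` when `D ⊆ Ω`). -/
noncomputable def twoPhase (Ω D : Set E3) (a₁ a₂ : ℝ) (x : E3) : ℝ :=
  (Ω \ D).indicator (fun _ => a₁) x + D.indicator (fun _ => a₂) x

/-- The volume fraction `|D| / |Ω|`. -/
noncomputable def volumeFraction (Ω D : Set E3) : ℝ :=
  volume.real D / volume.real Ω

/-- Test functions `φ ∈ 𝒟(U)`: smooth, with compact support contained in `U`. -/
def IsTestFunction (U : Set E3) (φ : E3 → ℝ) : Prop :=
  ContDiff ℝ ∞ φ ∧ HasCompactSupport φ ∧ tsupport φ ⊆ U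

/-- `v ∈ H¹(U)` with weak gradient `G`: both are square integrable on `U`, and
`∫_U v ∂ᵢφ = - ∫_U Gᵢ φ` for every test function `φ` and every `i`. -/
def IsH1 (U : Set E3) (v : E3 → ℝ) (G : E3 → E3) : Prop :=
  MemLp v 2 (volume.restrict U) ∧ MemLp G 2 (volume.restrict U) ∧
    ∀ φ : E3 → ℝ, IsTestFunction U φ → ∀ i : Fin 3,
      ∫ x in U, v x * fderiv ℝ φ x (EuclideanSpace.single i 1) = -∫ x in U, G x i * φ x

/-- Weak convergence in `H¹(U)` of `vₙ` (with weak gradients `Gₙ`) to `v` (with weak gradient `G`).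
As `w ↦ (w, ∇w)` embeds `H¹(U)` isometrically in `L²(U) × L²(U)³`, this is weak convergence in
`L²` of the functions and of their gradients. -/
def WeakTendstoH1 (U : Set E3) (v : ℕ → E3 → ℝ) (G : ℕ → E3 → E3)
    (v₀ : E3 → ℝ) (G₀ : E3 → E3) : Prop :=
  (∀ n, IsH1 U (v n) (G n)) ∧ IsH1 U v₀ G₀ ∧
  (∀ g : E3 → ℝ, MemLp g 2 (volume.restrict U) →
    Tendsto (fun n => ∫ x in U, v n x * g x) atTop (𝓝 (∫ x in U, v₀ x * g x))) ∧
  (∀ H : E3 → E3, MemLp H 2 (volume.restrict U) →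
    Tendsto (fun n => ∫ x in U, inner ℝ (G n x) (H x)) atTop
      (𝓝 (∫ x in U, inner ℝ (G₀ x) (H x))))

/-- `φ ∈ C₀(U)`: continuous on the closure of `U` and vanishing on the boundary of `U`. -/
def IsC0 (U : Set E3) (φ : E3 → ℝ) : Prop :=
  ContinuousOn φ (closure U) ∧ ∀ x ∈ frontier U, φ x = 0

/-- The integral `∫_U φ dμ` against a finite signed Borel measure, through its Jordan
decomposition. -/
noncomputable def signedIntegral (U : Set E3) (μ : SignedMeasure E3) (φ : E3 → ℝ) : ℝ :=
  (∫ x in U, φ x ∂μ.toJordanDecomposition.posPart) -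
    ∫ x in U, φ x ∂μ.toJordanDecomposition.negPart

/-- Weak-* convergence in `M(U)` of the integrable functions `fₙ` to the measure `μ`, tested
against `C₀(U)`. Only the restriction of `μ` to `U` matters. -/
def WeakStarTendsto (U : Set E3) (f : ℕ → E3 → ℝ) (μ : SignedMeasure E3) : Prop :=
  (∀ n, IntegrableOn (f n) U) ∧
  ∀ φ : E3 → ℝ, IsC0 U φ →
    Tendsto (fun n => ∫ x in U, φ x * f n x) atTop (𝓝 (signedIntegral U μ φ))

/-- On `U`, the measure `μ` is the function `g ∈ L^p(U)`, that is, `μ = g dx` on `U`. -/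
def IsLpDensity (U : Set E3) (μ : SignedMeasure E3) (p : ℝ≥0∞) (g : E3 → ℝ) : Prop :=
  MemLp g p (volume.restrict U) ∧ μ.restrict U = (volume.restrict U).withDensityᵥ g

/-- Convergence in `𝒟'(U)` of locally integrable functions. -/
def TendstoDistribution (U : Set E3) (u : ℕ → E3 → ℝ) (u₀ : E3 → ℝ) : Prop :=
  (∀ n, LocallyIntegrableOn (u n) U) ∧ LocallyIntegrableOn u₀ U ∧
  ∀ φ : E3 → ℝ, IsTestFunction U φ →
    Tendsto (fun n => ∫ x in U, u n x * φ x) atTop (𝓝 (∫ x in U, u₀ x * φ x))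

/-- The weighted Poincaré-Wirtinger inequality on the set `Q` with weight `α` and constant `c`. -/
def WeightedPoincareWirtinger (Q : Set E3) (α : E3 → ℝ) (c : ℝ) : Prop :=
  ∀ (w : E3 → ℝ) (G : E3 → E3), IsH1 Q w G →
    ∫ x in Q, α x * (w x - ⨍ y in Q, w y) ^ 2 ≤ c * ∫ x in Q, α x * ‖G x‖ ^ 2

end HighContrast

/-!
The statement is a compensated compactness result. The weights `αₙ` may be unbounded, but their
averages over the cells of size `εₙ` are bounded, so that an integral `∫ αₙ f` is comparable to
`∫ f` when `f` is almost constant in the cells. The weighted Poincaré–Wirtinger inequality says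
that functions with bounded weighted energy are almost constant in the cells, in the sense of
`L²(αₙ dx)`.

Concretely, let `vₙ ∈ H¹(Ω)` have bounded weighted energy and converge to `v` in `L²_loc(Ω)`, and
let `ψ ∈ C_c(Ω)`. In a cell `Q`, the function `vₙ - ψ` is the sum of `vₙ - ⨍ vₙ`, of the constant
`⨍ (vₙ - ψ)` and of `⨍ ψ - ψ`. Summing over the cells that meet a compact set `K ⊆ Ω`, the weighted
integrals of the squares of the first and third terms tend to zero, while that of the second is at
most `A ∫ |vₙ - ψ|²`. Hence `∫_K αₙ |vₙ - ψ|²` is asymptotically at most a multiple of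
`∫_Ω |v - ψ|²` (`IsCoefficientFamily.eventually_setIntegral_mul_sub_sq_le`). Everything follows from
this estimate.

* For `vₙ = 0`, it bounds `∫ αₙ ψ²` by a multiple of `∫ ψ²` in the limit. With `ψ = √|φ|`, a weak-*
  limit of `αₙ` is bounded on `C_c(Ω)` for the norm of `L¹(Ω)`, and has therefore a density in
  `L^∞(Ω)`. By the Cauchy–Schwarz inequality with weights `αₙ⁻¹` and `αₙ`, the limit `ξ` of `ξₙ` is
  bounded on `C_c(Ω)` for the norm of `L²(Ω)`, and has a density there by the Riesz representation
  theorem.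
* For the sequence `vₙ` of the theorem, strong convergence in `L²_loc(Ω)` is Rellich's theorem
  (`WeakTendstoH1.tendsto_integral_sub_sq`), deduced from the translation estimate
  `‖w(· + h) - w‖ ≤ ‖h‖ ‖∇w‖` in `L²`. If a test function `ψ` is close to `v` in `L²(Ω)`, then
  `∫ ξₙ (vₙ - ψ) φ` is small by the same Cauchy–Schwarz inequality, and `∫ ξₙ ψ φ` converges
  because `ψ φ` is a continuous function with compact support.

The weak-* compactness of `αₙ` comes from its bound in `L¹(Ω)` and Prokhorov's theorem.
-/

namespace HighContrast

/-! ### Square-integrable functions and test functions -/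

theorem IsTestFunction.mono {U V : Set E3} {φ : E3 → ℝ} (h : IsTestFunction U φ) (hUV : U ⊆ V) :
    IsTestFunction V φ :=
  ⟨h.1, h.2.1, h.2.2.trans hUV⟩

theorem IsTestFunction.eq_zero_of_notMem {U : Set E3} {φ : E3 → ℝ} (h : IsTestFunction U φ)
    {x : E3} (hx : x ∉ U) : φ x = 0 :=
  image_eq_zero_of_notMem_tsupport fun hx' => hx (h.2.2 hx')

theorem IsTestFunction.memLp {U : Set E3} {φ : E3 → ℝ} (h : IsTestFunction U φ) (p : ℝ≥0∞)
    (V : Set E3) : MemLp φ p (volume.restrict V) :=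
  (h.1.continuous.memLp_of_hasCompactSupport h.2.1).restrict V

/-- The classes in `L²(U)` of the test functions on `U`. -/
def testLp (U : Set E3) : Submodule ℝ (Lp ℝ 2 (volume.restrict U : Measure E3)) where
  carrier := {f | ∃ φ, IsTestFunction U φ ∧ f =ᵐ[volume.restrict U] φ}
  add_mem' := by
    rintro f g ⟨φ, hφ, hf⟩ ⟨ψ, hψ, hg⟩
    refine ⟨φ + ψ, ⟨hφ.1.add hψ.1, hφ.2.1.add hψ.2.1,
      (tsupport_add φ ψ).trans (union_subset hφ.2.2 hψ.2.2)⟩, ?_⟩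
    filter_upwards [Lp.coeFn_add f g, hf, hg] with x h1 h2 h3
    rw [h1, Pi.add_apply, Pi.add_apply, h2, h3]
  zero_mem' := by
    refine ⟨0, ⟨contDiff_const, HasCompactSupport.zero, ?_⟩, Lp.coeFn_zero _ _ _⟩
    simp [tsupport]
  smul_mem' := by
    rintro c f ⟨φ, hφ, hf⟩
    refine ⟨c • φ, ⟨hφ.1.const_smul c, hφ.2.1.smul_left (f := fun _ => c),
      (closure_mono (Function.support_const_smul_subset c φ)).trans hφ.2.2⟩, ?_⟩
    filter_upwards [Lp.coeFn_smul c f, hf] with x h1 h2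
    simp [h1, h2]

theorem inner_toLp {F : Type*} [NormedAddCommGroup F] [InnerProductSpace ℝ F] {μ : Measure E3}
    {f g : E3 → F} (hf : MemLp f 2 μ) (hg : MemLp g 2 μ) :
    inner ℝ (hf.toLp f) (hg.toLp g) = ∫ x, inner ℝ (f x) (g x) ∂μ := by
  rw [L2.inner_def]
  apply integral_congr_ae
  filter_upwards [hf.coeFn_toLp, hg.coeFn_toLp] with x h1 h2
  rw [h1, h2]

theorem norm_toLp_sq {F : Type*} [NormedAddCommGroup F] [InnerProductSpace ℝ F] {μ : Measure E3}
    {f : E3 → F} (hf : MemLp f 2 μ) : ‖hf.toLp f‖ ^ 2 = ∫ x, ‖f x‖ ^ 2 ∂μ := by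
  rw [← real_inner_self_eq_norm_sq, inner_toLp]
  simp

theorem norm_toLp_eq_sqrt {F : Type*} [NormedAddCommGroup F] [InnerProductSpace ℝ F]
    {μ : Measure E3} {f : E3 → F} (hf : MemLp f 2 μ) :
    ‖hf.toLp f‖ = √(∫ x, ‖f x‖ ^ 2 ∂μ) := by
  rw [← norm_toLp_sq hf, Real.sqrt_sq (norm_nonneg _)]

theorem integrable_inner_of_memLp_two {F : Type*} [NormedAddCommGroup F] [InnerProductSpace ℝ F]
    {μ : Measure E3} {f g : E3 → F} (hf : MemLp f 2 μ) (hg : MemLp g 2 μ) :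
    Integrable (fun x => inner ℝ (f x) (g x)) μ := by
  refine (L2.integrable_inner (𝕜 := ℝ) (hf.toLp f) (hg.toLp g)).congr ?_
  filter_upwards [hf.coeFn_toLp, hg.coeFn_toLp] with x h1 h2
  rw [h1, h2]

theorem integrable_mul_of_memLp_two {μ : Measure E3} {f g : E3 → ℝ} (hf : MemLp f 2 μ)
    (hg : MemLp g 2 μ) : Integrable (fun x => f x * g x) μ :=
  hf.integrable_mul hg

/-- The Cauchy–Schwarz inequality in `L²(μ; F)`. -/
theorem abs_integral_inner_le {F : Type*} [NormedAddCommGroup F] [InnerProductSpace ℝ F]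
    {μ : Measure E3} {f g : E3 → F} (hf : MemLp f 2 μ) (hg : MemLp g 2 μ) :
    |∫ x, inner ℝ (f x) (g x) ∂μ| ≤ √(∫ x, ‖f x‖ ^ 2 ∂μ) * √(∫ x, ‖g x‖ ^ 2 ∂μ) := by
  rw [← inner_toLp hf hg, ← norm_toLp_eq_sqrt hf, ← norm_toLp_eq_sqrt hg]
  exact abs_real_inner_le_norm _ _

theorem abs_integral_mul_le {μ : Measure E3} {f g : E3 → ℝ} (hf : MemLp f 2 μ)
    (hg : MemLp g 2 μ) :
    |∫ x, f x * g x ∂μ| ≤ √(∫ x, f x ^ 2 ∂μ) * √(∫ x, g x ^ 2 ∂μ) := by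
  simpa [mul_comm] using abs_integral_inner_le hg hf

/-- Test functions are dense in `L²(U)`: a function orthogonal to all of them vanishes. -/
theorem testLp_dense {U : Set E3} (hU : IsOpen U) :
    Dense (testLp U : Set (Lp ℝ 2 (volume.restrict U : Measure E3))) := by
  rw [Submodule.dense_iff_topologicalClosure_eq_top, Submodule.topologicalClosure_eq_top_iff,
    Submodule.eq_bot_iff]
  intro f hf
  have hloc : LocallyIntegrableOn f U :=
    locallyIntegrableOn_of_locallyIntegrable_restrict ((Lp.memLp f).locallyIntegrable (by norm_num))
  have := hU.ae_eq_zero_of_integral_contDiff_smul_eq_zero hloc (fun φ h1 h2 h3 => by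
    have hφ : IsTestFunction U φ := ⟨h1, h2, h3⟩
    have hm := hφ.memLp 2 U
    have h0 := (Submodule.mem_orthogonal _ _).1 hf (hm.toLp φ) ⟨φ, hφ, hm.coeFn_toLp⟩
    rw [L2.inner_def] at h0
    rw [← setIntegral_eq_integral_of_forall_compl_eq_zero (s := U)
      (fun x hx => by rw [hφ.eq_zero_of_notMem hx, zero_smul]), ← h0]
    apply integral_congr_ae
    filter_upwards [hm.coeFn_toLp] with x hx
    simp [hx, mul_comm])
  rw [Lp.eq_zero_iff_ae_eq_zero]
  exact (ae_restrict_iff' hU.measurableSet).2 this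

theorem exists_testFunction_integral_sub_sq_lt {U : Set E3} (hU : IsOpen U) {f : E3 → ℝ}
    (hf : MemLp f 2 (volume.restrict U)) {e : ℝ} (he : 0 < e) :
    ∃ φ, IsTestFunction U φ ∧ ∫ x in U, (f x - φ x) ^ 2 < e := by
  obtain ⟨g, ⟨φ, hφ, hg⟩, hd⟩ :=
    Metric.mem_closure_iff.1 (testLp_dense hU (hf.toLp f)) (√e) (by positivity)
  refine ⟨φ, hφ, ?_⟩
  have hm := hφ.memLp 2 U
  have hgφ : g = hm.toLp φ := Lp.ext (hg.trans hm.coeFn_toLp.symm)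
  rw [hgφ, dist_eq_norm, ← MemLp.toLp_sub, norm_toLp_eq_sqrt] at hd
  simpa using (Real.sqrt_lt_sqrt_iff (by positivity)).1 hd

/-- The `L²(U)` norm may be computed by duality with test functions. -/
theorem integral_sq_le_of_forall_testFunction {U : Set E3} (hU : IsOpen U) {f : E3 → ℝ}
    (hf : MemLp f 2 (volume.restrict U)) {M : ℝ}
    (h : ∀ φ, IsTestFunction U φ → |∫ x in U, f x * φ x| ≤ M * √(∫ x in U, φ x ^ 2)) :
    ∫ x in U, f x ^ 2 ≤ M ^ 2 := by
  have key : ∀ g : Lp ℝ 2 (volume.restrict U : Measure E3),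
      |inner ℝ (hf.toLp f) g| ≤ M * ‖g‖ := by
    intro g
    refine (testLp_dense hU).induction ?_ (isClosed_le (by fun_prop) (by fun_prop)) g
    rintro g ⟨φ, hφ, hg⟩
    have hm := hφ.memLp 2 U
    rw [show g = hm.toLp φ from Lp.ext (hg.trans hm.coeFn_toLp.symm), inner_toLp,
      norm_toLp_eq_sqrt]
    simpa [mul_comm] using h φ hφ
  have h1 := key (hf.toLp f)
  have h2 : ∫ x in U, f x ^ 2 = ‖hf.toLp f‖ ^ 2 := by rw [norm_toLp_sq]; simp
  rw [real_inner_self_eq_norm_sq, abs_of_nonneg (by positivity)] at h1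
  rw [h2]
  have h0 := norm_nonneg (hf.toLp f)
  rcases h0.eq_or_lt with h3 | h3
  · rw [← h3]; simpa using sq_nonneg M
  · have : ‖hf.toLp f‖ ≤ M := by nlinarith
    gcongr

/-- Weakly convergent sequences in `L²` are bounded, by the uniform boundedness principle. -/
theorem exists_bound_of_weakly_tendsto {F : Type*} [NormedAddCommGroup F] [InnerProductSpace ℝ F]
    [CompleteSpace F] {μ : Measure E3} {f : ℕ → E3 → F} (hf : ∀ n, MemLp (f n) 2 μ)
    {l : (E3 → F) → ℝ} (h : ∀ g, MemLp g 2 μ →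
      Tendsto (fun n => ∫ x, inner ℝ (f n x) (g x) ∂μ) atTop (𝓝 (l g))) :
    ∃ C, ∀ n, ∫ x, ‖f n x‖ ^ 2 ∂μ ≤ C := by
  obtain ⟨C, hC⟩ := banach_steinhaus (g := fun n => innerSL ℝ ((hf n).toLp (f n))) (by
    intro g
    have h1 := h g (Lp.memLp g)
    obtain ⟨C, hC⟩ := h1.norm.bddAbove_range
    refine ⟨C, fun n => ?_⟩
    refine le_of_eq_of_le ?_ (hC ⟨n, rfl⟩)
    simp only [innerSL_apply_apply]
    rw [← inner_toLp (hf n) (Lp.memLp g), Lp.toLp_coeFn])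
  refine ⟨C ^ 2, fun n => ?_⟩
  have := hC n
  rw [innerSL_apply_norm] at this
  rw [← norm_toLp_sq (hf n)]
  gcongr

end HighContrast

namespace HighContrast

/-! ### Local strong convergence of weakly convergent sequences in `H¹` -/

theorem IsH1.mono {U V : Set E3} {w : E3 → ℝ} {H : E3 → E3} (h : IsH1 U w H) (hVU : V ⊆ U) :
    IsH1 V w H := by
  refine ⟨h.1.mono_measure (Measure.restrict_mono hVU le_rfl),
    h.2.1.mono_measure (Measure.restrict_mono hVU le_rfl), fun φ hφ i => ?_⟩
  have h1 : ∀ x, x ∉ V → fderiv ℝ φ x = 0 := fun x hx =>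
    image_eq_zero_of_notMem_tsupport fun hx' =>
      hx (hφ.2.2 (tsupport_fderiv_subset ℝ hx'))
  have key : ∀ f : E3 → ℝ, (∀ x ∉ V, f x = 0) → ∫ x in V, f x = ∫ x in U, f x := fun f hf =>
    (setIntegral_eq_integral_of_forall_compl_eq_zero hf).trans
      (setIntegral_eq_integral_of_forall_compl_eq_zero fun x hx => hf x fun hx' =>
        hx (hVU hx')).symm
  rw [key _ fun x hx => by rw [h1 x hx]; simp,
    key _ fun x hx => by rw [hφ.eq_zero_of_notMem hx, mul_zero]]
  exact h.2.2 φ (hφ.mono hVU) i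

theorem IsH1.congr {U : Set E3} {w w' : E3 → ℝ} {H : E3 → E3} (h : IsH1 U w H)
    (hw : w =ᵐ[volume.restrict U] w') : IsH1 U w' H := by
  refine ⟨h.1.ae_eq hw, h.2.1, fun φ hφ i => ?_⟩
  rw [← h.2.2 φ hφ i]
  apply integral_congr_ae
  filter_upwards [hw] with x hx
  rw [hx]

theorem isH1_zero (U : Set E3) : IsH1 U 0 0 :=
  ⟨MemLp.zero, MemLp.zero, fun φ _ i => by simp⟩

theorem IsTestFunction.integrable_mul_fderiv {U : Set E3} {w φ : E3 → ℝ}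
    (hw : MemLp w 2 (volume.restrict U)) (hφ : IsTestFunction U φ) (h : E3) :
    Integrable (fun x => w x * fderiv ℝ φ x h) (volume.restrict U) := by
  have hc : Continuous fun x => fderiv ℝ φ x h :=
    (hφ.1.continuous_fderiv (by simp)).clm_apply continuous_const
  have hs : HasCompactSupport fun x => fderiv ℝ φ x h :=
    (hφ.2.1.fderiv (𝕜 := ℝ)).comp_left (g := fun L : E3 →L[ℝ] ℝ => L h) (by simp)
  exact integrable_mul_of_memLp_two hw ((hc.memLp_of_hasCompactSupport hs).restrict U)

theorem IsH1.sub {U : Set E3} {w w' : E3 → ℝ} {H H' : E3 → E3} (h : IsH1 U w H)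
    (h' : IsH1 U w' H') : IsH1 U (fun x => w x - w' x) (fun x => H x - H' x) := by
  refine ⟨h.1.sub h'.1, h.2.1.sub h'.2.1, fun φ hφ i => ?_⟩
  have hm : ∀ K : E3 → E3, MemLp K 2 (volume.restrict U) →
      Integrable (fun x => K x i * φ x) (volume.restrict U) := fun K hK =>
    (hK.eval_piLp i).integrable_mul (hφ.memLp 2 U)
  simp only [sub_mul, PiLp.sub_apply]
  rw [integral_sub (hφ.integrable_mul_fderiv h.1 _) (hφ.integrable_mul_fderiv h'.1 _),
    integral_sub (hm H h.2.1) (hm H' h'.2.1), h.2.2 φ hφ i, h'.2.2 φ hφ i]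
  ring

/-- The weak derivative of an `H¹` function in an arbitrary direction `h`. -/
theorem IsH1.integral_mul_fderiv {U : Set E3} {w φ : E3 → ℝ} {H : E3 → E3} (hw : IsH1 U w H)
    (hφ : IsTestFunction U φ) (h : E3) :
    ∫ x in U, w x * fderiv ℝ φ x h = -∫ x in U, inner ℝ (H x) (φ x • h) := by
  have hh : h = ∑ i : Fin 3, h i • EuclideanSpace.single i (1 : ℝ) := by
    ext j
    fin_cases j <;> simp [Fin.sum_univ_three]
  have e1 : ∀ x, w x * fderiv ℝ φ x h =
      ∑ i : Fin 3, h i * (w x * fderiv ℝ φ x (EuclideanSpace.single i 1)) := by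
    intro x
    conv_lhs => rw [hh]
    simp only [map_sum, map_smul, smul_eq_mul, Finset.mul_sum]
    exact Finset.sum_congr rfl fun i _ => by ring
  have e2 : ∀ x, inner ℝ (H x) (φ x • h) = ∑ i : Fin 3, h i * (H x i * φ x) := by
    intro x
    simp only [PiLp.inner_apply, PiLp.smul_apply, smul_eq_mul, RCLike.inner_apply, conj_trivial]
    exact Finset.sum_congr rfl fun i _ => by ring
  have e3 : ∀ i, Integrable (fun x => H x i * φ x) (volume.restrict U) := fun i =>
    (hw.2.1.eval_piLp i).integrable_mul (hφ.memLp 2 U)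
  simp only [e1, e2]
  rw [integral_finsetSum _ fun i _ => (hφ.integrable_mul_fderiv hw.1 _).const_mul _,
    integral_finsetSum _ fun i _ => (e3 i).const_mul _,
    ← Finset.sum_neg_distrib]
  refine Finset.sum_congr rfl fun i _ => ?_
  rw [integral_const_mul, integral_const_mul, hw.2.2 φ hφ i]
  ring

theorem IsTestFunction.translate {U V : Set E3} {φ : E3 → ℝ} (hφ : IsTestFunction V φ) {a : E3}
    (ha : ∀ x ∈ V, x + a ∈ U) : IsTestFunction U fun x => φ (x - a) := by
  refine ⟨hφ.1.comp (contDiff_id.sub contDiff_const),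
    hφ.2.1.comp_homeomorph (Homeomorph.subRight a), fun x hx => ?_⟩
  have : x - a ∈ tsupport φ :=
    tsupport_comp_subset_preimage φ (f := fun x => x - a) (by fun_prop) hx
  simpa using ha _ (hφ.2.2 this)

/-- The translation estimate of `H¹` functions, tested against a test function `φ`: it is the mean
value inequality for `t ↦ ∫ w(x) φ(x - t h) dx`, as the weak derivative can be moved from `φ`
onto `w`. -/
theorem IsH1.abs_integral_translate_sub_le {U V : Set E3} (hUb : Bornology.IsBounded U)
    {w φ : E3 → ℝ} {H : E3 → E3} (hw : IsH1 U w H) (hφ : IsTestFunction V φ) {h : E3}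
    (hV : ∀ x ∈ V, ∀ t ∈ Icc (0 : ℝ) 1, x + t • h ∈ U) :
    |∫ x in V, (w (x + h) - w x) * φ x| ≤
      (‖h‖ * √(∫ x in U, ‖H x‖ ^ 2)) * √(∫ x in V, φ x ^ 2) := by
  have : IsFiniteMeasure (volume.restrict U : Measure E3) :=
    ⟨by simpa using hUb.measure_lt_top⟩
  obtain ⟨C, hC⟩ := (hφ.2.1.fderiv (𝕜 := ℝ)).exists_bound_of_continuous
    (hφ.1.continuous_fderiv (by simp))
  have hC0 : 0 ≤ C := (norm_nonneg _).trans (hC 0)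
  have hφd : Differentiable ℝ φ := hφ.1.differentiable (by simp)
  have hVU : ∀ x ∈ V, x ∈ U := fun x hx => by simpa using hV x hx 0 (by simp)
  let F : ℝ → ℝ := fun t => ∫ x in U, w x * φ (x - t • h)
  have hline : ∀ (x : E3) (t : ℝ), HasDerivAt (fun t : ℝ => x - t • h) (-h) t := fun x t => by
    simpa using ((hasDerivAt_id t).smul_const h).const_sub x
  have hF : ∀ t, HasDerivAt F (∫ x in U, w x * fderiv ℝ φ (x - t • h) (-h)) t := by
    intro t
    have hφb : MemLp φ 2 volume := hφ.1.continuous.memLp_of_hasCompactSupport hφ.2.1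
    refine (hasDerivAt_integral_of_dominated_loc_of_deriv_le (μ := volume.restrict U)
      (F := fun t x => w x * φ (x - t • h)) (s := univ)
      (F' := fun t x => w x * fderiv ℝ φ (x - t • h) (-h))
      (bound := fun x => ‖w x‖ * (C * ‖h‖)) univ_mem ?_ ?_ ?_ ?_ ?_ ?_).2
    · exact Eventually.of_forall fun s => hw.1.1.mul
        (hφ.1.continuous.comp (continuous_id.sub continuous_const)).aestronglyMeasurable
    · have hm : MemLp (fun x => φ (x - t • h)) 2 (volume.restrict U) :=
        (hφb.comp_measurePreserving (measurePreserving_sub_right volume (t • h))).restrict U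
      exact hw.1.integrable_mul hm
    · exact hw.1.1.mul (((hφ.1.continuous_fderiv (by simp)).comp
        (continuous_id.sub continuous_const)).clm_apply continuous_const).aestronglyMeasurable
    · refine Eventually.of_forall fun x s _ => ?_
      rw [norm_mul]
      gcongr
      exact (ContinuousLinearMap.le_opNorm _ _).trans (by rw [norm_neg]; gcongr; exact hC _)
    · exact ((hw.1.integrable (by norm_num)).norm).mul_const _
    · refine Eventually.of_forall fun x s _ => ?_
      exact ((hφd _).hasFDerivAt.comp_hasDerivAt s (hline x s)).const_mul (w x)
  have hbound : ∀ t ∈ Icc (0 : ℝ) 1, ‖∫ x in U, w x * fderiv ℝ φ (x - t • h) (-h)‖ ≤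
      (‖h‖ * √(∫ x in U, ‖H x‖ ^ 2)) * √(∫ x in V, φ x ^ 2) := by
    intro t ht
    have hφt : IsTestFunction U fun x => φ (x - t • h) :=
      hφ.translate fun x hx => hV x hx t ht
    have e : ∀ x, fderiv ℝ φ (x - t • h) = fderiv ℝ (fun x => φ (x - t • h)) x := fun x => by
      rw [fderiv_comp_sub]
    simp only [e]
    rw [hw.integral_mul_fderiv hφt, norm_neg, Real.norm_eq_abs]
    have hm : MemLp (fun x => φ (x - t • h) • -h) 2 (volume.restrict U) :=
      (memLp_const (-h) (p := ∞)).smul (hφt.memLp 2 U)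
    refine (abs_integral_inner_le hw.2.1 hm).trans_eq ?_
    have e2 : ∫ x in U, ‖φ (x - t • h) • -h‖ ^ 2 = ‖h‖ ^ 2 * ∫ x in V, φ x ^ 2 := by
      simp only [norm_smul, norm_neg, mul_pow, Real.norm_eq_abs, sq_abs]
      rw [integral_mul_const, mul_comm, setIntegral_eq_integral_of_forall_compl_eq_zero
        fun x hx => by rw [hφt.eq_zero_of_notMem hx]; simp,
        setIntegral_eq_integral_of_forall_compl_eq_zero
        fun x hx => by rw [hφ.eq_zero_of_notMem hx]; simp,
        integral_sub_right_eq_self (fun x => φ x ^ 2)]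
    rw [e2, Real.sqrt_mul (by positivity), Real.sqrt_sq (norm_nonneg _)]
    ring
  have key := norm_image_sub_le_of_norm_deriv_le_segment_01'
    (fun t _ => (hF t).hasDerivWithinAt) fun t ht => hbound t ⟨ht.1, ht.2.le⟩
  refine le_of_eq_of_le ?_ key
  -- the functions `w(x) φ(x - t h)` for `t = 0, 1`, extended by zero outside `U`
  have hint : ∀ a : E3, (∀ x ∈ V, x + a ∈ U) → Integrable (fun x => w x * φ (x - a)) ∧
      ∫ x in U, w x * φ (x - a) = ∫ x, w x * φ (x - a) := by
    intro a ha
    have hφa : IsTestFunction U fun x => φ (x - a) := hφ.translate ha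
    have hz : ∀ x ∉ U, w x * φ (x - a) = 0 := fun x hx => by
      rw [hφa.eq_zero_of_notMem hx, mul_zero]
    refine ⟨?_, setIntegral_eq_integral_of_forall_compl_eq_zero hz⟩
    have h1 : IntegrableOn (fun x => w x * φ (x - a)) U := hw.1.integrable_mul (hφa.memLp 2 U)
    exact h1.integrable_of_forall_notMem_eq_zero hz
  obtain ⟨i1, e1⟩ := hint h fun x hx => by simpa using hV x hx 1 (by simp)
  obtain ⟨i0, e0⟩ := hint 0 (by simpa using hVU)
  have eF1 : F 1 = ∫ x, w (x + h) * φ x := by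
    simp only [F, one_smul]
    rw [e1, ← integral_add_right_eq_self _ h]
    simp
  have eF0 : F 0 = ∫ x, w x * φ x := by
    simp only [F, zero_smul]
    rw [e0]
    simp
  have i1' : Integrable fun x => w (x + h) * φ x := by simpa using i1.comp_add_right h
  rw [Real.norm_eq_abs, eF1, eF0, ← integral_sub i1' (by simpa using i0),
    setIntegral_eq_integral_of_forall_compl_eq_zero
      fun x hx => by rw [hφ.eq_zero_of_notMem hx, mul_zero]]
  simp only [sub_mul]

/-- The translation estimate `‖w(· + h) - w‖ ≤ ‖h‖ ‖∇w‖` in `L²`. -/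
theorem IsH1.integral_translate_sub_sq_le {U V : Set E3} (hUb : Bornology.IsBounded U)
    (hVo : IsOpen V) {w : E3 → ℝ} {H : E3 → E3} (hw : IsH1 U w H) (hw2 : MemLp w 2) {h : E3}
    (hV : ∀ x ∈ V, ∀ t ∈ Icc (0 : ℝ) 1, x + t • h ∈ U) :
    ∫ x in V, (w (x + h) - w x) ^ 2 ≤ ‖h‖ ^ 2 * ∫ x in U, ‖H x‖ ^ 2 := by
  have hm : MemLp (fun x => w (x + h) - w x) 2 (volume.restrict V) :=
    ((hw2.comp_measurePreserving (measurePreserving_add_right volume h)).sub hw2).restrict V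
  refine (integral_sq_le_of_forall_testFunction hVo hm fun φ hφ =>
    hw.abs_integral_translate_sub_le hUb hφ hV).trans_eq ?_
  rw [mul_pow, Real.sq_sqrt (by positivity)]

end HighContrast

namespace HighContrast

theorem stronglyMeasurable_translate {w : E3 → ℝ} (hw : StronglyMeasurable w) :
    StronglyMeasurable fun p : E3 × E3 => w (p.1 + p.2) :=
  hw.comp_measurable (by fun_prop)

/-- An `H¹` function `w` is controlled in `L²` by its averages `m(x)` over the balls of radius `δ`,
up to an error of order `δ ‖∇w‖`. Expanding the square and dropping the term in `w(x + h)²`,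
`w(x)² ≤ 2 w(x) m(x) + ⨍_{|h| < δ} (w(x + h) - w(x))² dh`. -/
theorem IsH1.integral_sq_le_average {U V : Set E3} (hUb : Bornology.IsBounded U)
    (hVo : IsOpen V) {w : E3 → ℝ} {H : E3 → E3} (hw : IsH1 U w H) (hwm : StronglyMeasurable w)
    (hw2 : MemLp w 2) {δ : ℝ} (hδ : 0 < δ) (hV : ∀ x ∈ V, Metric.ball x δ ⊆ U)
    (hm2 : IntegrableOn (fun x => (⨍ h in Metric.ball (0 : E3) δ, w (x + h)) ^ 2) V) :
    ∫ x in V, w x ^ 2 ≤ 4 * (∫ x in V, (⨍ h in Metric.ball (0 : E3) δ, w (x + h)) ^ 2) +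
      2 * (δ ^ 2 * ∫ x in U, ‖H x‖ ^ 2) := by
  set B := Metric.ball (0 : E3) δ
  set b := volume.real B with hb
  have hBfin : volume B ≠ ⊤ := measure_ball_lt_top.ne
  have hb0 : 0 < b := ENNReal.toReal_pos (Metric.measure_ball_pos _ _ hδ).ne' hBfin
  have hBF : IsFiniteMeasure (volume.restrict B : Measure E3) := ⟨by simpa using hBfin.lt_top⟩
  let m : E3 → ℝ := fun x => ⨍ h in B, w (x + h)
  let D : E3 → E3 → ℝ := fun x h => (w (x + h) - w x) ^ 2
  have htr : ∀ h : E3, MemLp (fun x => w (x + h)) 2 := fun h =>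
    hw2.comp_measurePreserving (measurePreserving_add_right volume h)
  have htl : ∀ x : E3, MemLp (fun h => w (x + h)) 2 := fun x =>
    hw2.comp_measurePreserving (measurePreserving_add_left volume x)
  have hDh : ∀ h ∈ B, ∫ x in V, D x h ≤ δ ^ 2 * ∫ x in U, ‖H x‖ ^ 2 := by
    intro h hh
    have hn : ‖h‖ < δ := by simpa [B] using hh
    refine (hw.integral_translate_sub_sq_le hUb hVo hw2 fun x hx t ht => hV x hx ?_).trans ?_
    · rw [mem_ball_iff_norm, add_sub_cancel_left, norm_smul, Real.norm_of_nonneg ht.1]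
      exact (mul_le_of_le_one_left (norm_nonneg _) ht.2).trans_lt hn
    · gcongr
  have hDm : StronglyMeasurable fun p : E3 × E3 => D p.1 p.2 :=
    ((stronglyMeasurable_translate hwm).sub (hwm.comp_measurable measurable_fst)).pow 2
  have hDint : Integrable (fun p : E3 × E3 => D p.1 p.2)
      ((volume.restrict V).prod (volume.restrict B)) := by
    rw [integrable_prod_iff' hDm.aestronglyMeasurable]
    refine ⟨Eventually.of_forall fun h => (((htr h).sub hw2).restrict V).integrable_sq, ?_⟩
    refine (integrable_const (δ ^ 2 * ∫ x in U, ‖H x‖ ^ 2)).mono'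
      (hDm.norm.integral_prod_left' (μ := volume.restrict V)).aestronglyMeasurable ?_
    filter_upwards [ae_restrict_mem Metric.isOpen_ball.measurableSet] with h hh
    rw [Real.norm_of_nonneg (by positivity)]
    simpa [D] using hDh h hh
  have hswap : ∫ x in V, ∫ h in B, D x h ≤ b * (δ ^ 2 * ∫ x in U, ‖H x‖ ^ 2) := by
    rw [integral_integral_swap hDint]
    refine (setIntegral_mono_on hDint.integral_prod_right (integrable_const _)
      Metric.isOpen_ball.measurableSet hDh).trans_eq ?_
    simp [hb]
  have hpt : ∀ x, w x ^ 2 ≤ 4 * m x ^ 2 + 2 / b * ∫ h in B, D x h := by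
    intro x
    have i1 : Integrable (fun h => w (x + h)) (volume.restrict B) :=
      ((htl x).restrict B).integrable (by norm_num)
    have i2 : Integrable (fun h => w (x + h) ^ 2) (volume.restrict B) :=
      ((htl x).restrict B).integrable_sq
    have i3 : Integrable (fun h => 2 * w (x + h) * w x) (volume.restrict B) :=
      (i1.const_mul 2).mul_const _
    have i4 : Integrable (fun h => w (x + h) ^ 2 - 2 * w (x + h) * w x) (volume.restrict B) :=
      i2.sub i3
    have hmb : ∫ h in B, w (x + h) = b * m x := by
      simp only [m, setAverage_eq, smul_eq_mul, ← hb]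
      field_simp
    have e : ∫ h in B, D x h = (∫ h in B, w (x + h) ^ 2) - 2 * w x * (b * m x) + b * w x ^ 2 := by
      simp only [D, sub_sq]
      rw [integral_add i4 (integrable_const _), integral_sub i2 i3, integral_mul_const,
        integral_const_mul, hmb]
      simp [← hb]
      ring
    have h0 : 0 ≤ ∫ h in B, w (x + h) ^ 2 := integral_nonneg fun _ => sq_nonneg _
    have h1 : b * w x ^ 2 - 2 * b * (w x * m x) ≤ ∫ h in B, D x h := by rw [e]; linarith
    have h2 : 2 / b * (b * w x ^ 2 - 2 * b * (w x * m x)) ≤ 2 / b * ∫ h in B, D x h := by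
      gcongr
    have h3 : 2 / b * (b * w x ^ 2 - 2 * b * (w x * m x)) = 2 * w x ^ 2 - 4 * (w x * m x) := by
      field_simp
      ring
    nlinarith [sq_nonneg (w x - 2 * m x)]
  have hD1 : IntegrableOn (fun x => ∫ h in B, D x h) V := hDint.integral_prod_left
  calc ∫ x in V, w x ^ 2 ≤ ∫ x in V, (4 * m x ^ 2 + 2 / b * ∫ h in B, D x h) :=
        integral_mono (hw2.restrict V).integrable_sq ((hm2.const_mul 4).add (hD1.const_mul _)) hpt
    _ = 4 * (∫ x in V, m x ^ 2) + 2 / b * ∫ x in V, ∫ h in B, D x h := by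
        rw [integral_add (hm2.const_mul 4) (hD1.const_mul _), integral_const_mul,
          integral_const_mul]
    _ ≤ 4 * (∫ x in V, m x ^ 2) + 2 / b * (b * (δ ^ 2 * ∫ x in U, ‖H x‖ ^ 2)) := by gcongr
    _ = _ := by simp only [m]; field_simp

/-- Rellich's theorem, for weak convergence to zero: if `wₙ ⇀ 0` in `L²(Ω)` with bounded gradients,
then `wₙ → 0` in `L²(K)`, as the averages of `wₙ` over balls of a fixed radius converge to zero
boundedly. -/
theorem tendsto_integral_sq_zero_of_weakly {Ω K : Set E3} (hΩ : IsOpen Ω)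
    (hΩb : Bornology.IsBounded Ω) (hK : IsCompact K) (hKΩ : K ⊆ Ω) {u : ℕ → E3 → ℝ}
    {H : ℕ → E3 → E3} (hu : ∀ n, IsH1 Ω (u n) (H n)) {C : ℝ}
    (hC : ∀ n, ∫ x in Ω, ‖H n x‖ ^ 2 ≤ C)
    (hweak : ∀ g : E3 → ℝ, MemLp g 2 (volume.restrict Ω) →
      Tendsto (fun n => ∫ x in Ω, u n x * g x) atTop (𝓝 0)) :
    Tendsto (fun n => ∫ x in K, u n x ^ 2) atTop (𝓝 0) := by
  obtain ⟨C', hC'⟩ := exists_bound_of_weakly_tendsto (fun n => (hu n).1) (l := fun _ => 0)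
    (fun g hg => by simpa [mul_comm] using hweak g hg)
  have hmem : ∀ n, MemLp (Ω.indicator (u n)) 2 := fun n =>
    (memLp_indicator_iff_restrict hΩ.measurableSet).2 (hu n).1
  -- measurable representatives defined on the whole space
  let w : ℕ → E3 → ℝ := fun n => (hmem n).1.mk
  have hwm : ∀ n, StronglyMeasurable (w n) := fun n => (hmem n).1.stronglyMeasurable_mk
  have hwae : ∀ n, w n =ᵐ[volume] Ω.indicator (u n) := fun n => (hmem n).1.ae_eq_mk.symm
  have hw2 : ∀ n, MemLp (w n) 2 := fun n => (hmem n).ae_eq (hwae n).symm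
  have hwu : ∀ n, u n =ᵐ[volume.restrict Ω] w n := fun n => by
    filter_upwards [ae_restrict_of_ae (hwae n), ae_restrict_mem hΩ.measurableSet] with x h1 h2
    rw [h1, indicator_of_mem h2]
  have hwH : ∀ n, IsH1 Ω (w n) (H n) := fun n => (hu n).congr (hwu n)
  obtain ⟨r, hr, hrΩ⟩ := hK.exists_thickening_subset_open hΩ hKΩ
  rw [Metric.tendsto_atTop]
  intro e he
  have hC0 : 0 ≤ C := (integral_nonneg fun _ => by positivity).trans (hC 0)
  -- the radius of the averages is chosen with `2 δ² C < e / 2`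
  obtain ⟨δ, hδ, hδr, hδe⟩ : ∃ δ : ℝ, 0 < δ ∧ δ < r / 2 ∧ 2 * (δ ^ 2 * C) < e / 2 := by
    have h1 : Tendsto (fun δ : ℝ => 2 * (δ ^ 2 * C)) (𝓝[>] 0) (𝓝 (2 * (0 ^ 2 * C))) :=
      ((Continuous.tendsto (by fun_prop) 0).mono_left nhdsWithin_le_nhds)
    have h2 := h1.eventually_lt_const (u := e / 2) (by simpa using by positivity)
    have h3 : ∀ᶠ δ : ℝ in 𝓝[>] 0, δ < r / 2 :=
      ((continuous_id.tendsto (0 : ℝ)).mono_left nhdsWithin_le_nhds).eventually_lt_const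
        (by simpa using by positivity)
    obtain ⟨δ, ⟨h4, h5⟩, h6⟩ := ((h2.and h3).and self_mem_nhdsWithin).exists
    exact ⟨δ, h6, h5, h4⟩
  let V := Metric.thickening (r / 2) K
  have hVo : IsOpen V := Metric.isOpen_thickening
  have hKV : K ⊆ V := Metric.self_subset_thickening (by positivity) K
  have hVΩ : ∀ x ∈ V, Metric.ball x δ ⊆ Ω := by
    intro x hx y hy
    obtain ⟨z, hz, hxz⟩ := Metric.mem_thickening_iff.1 hx
    refine hrΩ (Metric.mem_thickening_iff.2 ⟨z, hz, ?_⟩)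
    have := dist_triangle y x z
    rw [Metric.mem_ball] at hy
    linarith
  have hVb : Bornology.IsBounded V := hΩb.subset fun x hx => hVΩ x hx (Metric.mem_ball_self hδ)
  have hVF : IsFiniteMeasure (volume.restrict V : Measure E3) :=
    ⟨by simpa using hVb.measure_lt_top⟩
  set B := Metric.ball (0 : E3) δ
  let m : ℕ → E3 → ℝ := fun n x => ⨍ h in B, w n (x + h)
  have hmm : ∀ n, StronglyMeasurable (m n) := by
    intro n
    simp only [m, setAverage_eq]
    exact (stronglyMeasurable_const (β := ℝ)).smul
      ((stronglyMeasurable_translate (hwm n)).integral_prod_right' (ν := volume.restrict B))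
  have hball : ∀ x : E3, MemLp ((Metric.ball x δ).indicator fun _ => (1 : ℝ)) 2
      (volume.restrict Ω) := fun x =>
    (memLp_indicator_const 2 Metric.isOpen_ball.measurableSet 1
      (Or.inr measure_ball_lt_top.ne)).restrict Ω
  have hmeq : ∀ n, ∀ x ∈ V, m n x = (volume.real B)⁻¹ *
      ∫ y in Ω, u n y * (Metric.ball x δ).indicator (fun _ => (1 : ℝ)) y := by
    intro n x hx
    simp only [m, setAverage_eq, smul_eq_mul]
    congr 1
    have e1 : ∫ y in Ω, u n y * (Metric.ball x δ).indicator (fun _ => (1 : ℝ)) y =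
        ∫ y, (Metric.ball x δ).indicator (w n) y := by
      rw [← integral_indicator hΩ.measurableSet]
      apply integral_congr_ae
      filter_upwards [hwae n] with y hy
      by_cases h1 : y ∈ Metric.ball x δ
      · simp [h1, hy, hVΩ x hx h1]
      · simp [h1]
    rw [e1, ← integral_indicator Metric.isOpen_ball.measurableSet,
      ← integral_add_left_eq_self ((Metric.ball x δ).indicator (w n)) x]
    congr 1
    ext h
    simp [indicator]
  have hmb : ∀ n, ∀ x ∈ V, ‖m n x ^ 2‖ ≤ ((volume.real B)⁻¹ * (√C' * √(volume.real B))) ^ 2 := by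
    intro n x hx
    rw [norm_pow, hmeq n x hx, norm_mul, Real.norm_of_nonneg (by positivity)]
    gcongr
    refine (abs_integral_mul_le (hu n).1 (hball x)).trans ?_
    gcongr
    · simpa using hC' n
    · have : ∀ y, (Metric.ball x δ).indicator (fun _ => (1 : ℝ)) y ^ 2 =
          (Metric.ball x δ).indicator (fun _ => (1 : ℝ)) y := fun y => by
        by_cases h : y ∈ Metric.ball x δ <;> simp [h]
      simp only [this]
      rw [integral_indicator Metric.isOpen_ball.measurableSet,
        Measure.restrict_restrict Metric.isOpen_ball.measurableSet]
      simp only [integral_const, smul_eq_mul, mul_one, measureReal_restrict_apply_univ]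
      rw [show volume.real B = volume.real (Metric.ball x δ) by
        simp [B, Measure.real, EuclideanSpace.volume_ball]]
      exact measureReal_mono inter_subset_left measure_ball_lt_top.ne
  have hmint : ∀ n, IntegrableOn (fun x => m n x ^ 2) V := fun n =>
    (integrable_const (((volume.real B)⁻¹ * (√C' * √(volume.real B))) ^ 2)).mono'
      ((hmm n).pow 2).aestronglyMeasurable
      ((ae_restrict_iff' hVo.measurableSet).2 (Eventually.of_forall (hmb n)))
  have hm0 : Tendsto (fun n => ∫ x in V, m n x ^ 2) atTop (𝓝 0) := by
    have := tendsto_integral_of_dominated_convergence (μ := volume.restrict V)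
      (F := fun n x => m n x ^ 2) (f := fun _ => (0 : ℝ)) _
      (fun n => ((hmm n).pow 2).aestronglyMeasurable)
      (integrable_const (((volume.real B)⁻¹ * (√C' * √(volume.real B))) ^ 2))
      (fun n => (ae_restrict_iff' hVo.measurableSet).2 (Eventually.of_forall (hmb n)))
      ((ae_restrict_iff' hVo.measurableSet).2 (Eventually.of_forall fun x hx => by
        simp only [hmeq _ x hx]
        simpa using ((hweak _ (hball x)).const_mul (volume.real B)⁻¹).pow 2))
    simpa using this
  obtain ⟨N, hN⟩ := eventually_atTop.1 (hm0.eventually_lt_const (u := e / 8) (by positivity))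
  refine ⟨N, fun n hn => ?_⟩
  rw [Real.dist_eq, sub_zero, abs_of_nonneg (integral_nonneg fun _ => sq_nonneg _)]
  have h1 := (hwH n).integral_sq_le_average hΩb hVo (hwm n) (hw2 n) hδ hVΩ (hmint n)
  have h2 : ∫ x in K, u n x ^ 2 ≤ ∫ x in V, w n x ^ 2 := by
    have : ∫ x in K, u n x ^ 2 = ∫ x in K, w n x ^ 2 := by
      apply integral_congr_ae
      filter_upwards [ae_restrict_of_ae_restrict_of_subset hKΩ (hwu n)] with x hx
      rw [hx]
    rw [this]
    exact setIntegral_mono_set (hw2 n).integrable_sq.integrableOn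
      (Eventually.of_forall fun _ => sq_nonneg _) hKV.eventuallyLE
  have h3 := hN n hn
  have h4 : 2 * (δ ^ 2 * ∫ x in Ω, ‖H n x‖ ^ 2) ≤ 2 * (δ ^ 2 * C) := by
    gcongr
    exact hC n
  linarith

theorem WeakTendstoH1.tendsto_integral_sub_sq {Ω K : Set E3} (hΩ : IsOpen Ω)
    (hΩb : Bornology.IsBounded Ω) (hK : IsCompact K) (hKΩ : K ⊆ Ω) {v : ℕ → E3 → ℝ}
    {G : ℕ → E3 → E3} {v₀ : E3 → ℝ} {G₀ : E3 → E3} (h : WeakTendstoH1 Ω v G v₀ G₀) :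
    Tendsto (fun n => ∫ x in K, (v n x - v₀ x) ^ 2) atTop (𝓝 0) := by
  have hsub : ∀ n, IsH1 Ω (fun x => v n x - v₀ x) (fun x => G n x - G₀ x) := fun n =>
    (h.1 n).sub h.2.1
  obtain ⟨C, hC⟩ := exists_bound_of_weakly_tendsto (fun n => (hsub n).2.1) (l := fun _ => 0)
    (fun g hg => by
      have h1 := (h.2.2.2 g hg).sub_const (∫ x in Ω, inner ℝ (G₀ x) (g x))
      rw [sub_self] at h1
      refine h1.congr fun n => ?_
      have hi : ∀ K : E3 → E3, MemLp K 2 (volume.restrict Ω) →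
          IntegrableOn (fun x => inner ℝ (K x) (g x)) Ω := fun K hK =>
        integrable_inner_of_memLp_two hK hg
      simp only [inner_sub_left]
      rw [integral_sub (hi _ (h.1 n).2.1) (hi _ h.2.1.2.1)])
  refine tendsto_integral_sq_zero_of_weakly hΩ hΩb hK hKΩ hsub hC fun g hg => ?_
  have h1 := (h.2.2.1 g hg).sub_const (∫ x in Ω, v₀ x * g x)
  rw [sub_self] at h1
  refine h1.congr fun n => ?_
  simp only [sub_mul]
  rw [integral_sub (integrable_mul_of_memLp_two (h.1 n).1 hg)
    (integrable_mul_of_memLp_two h.2.1.1 hg)]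

end HighContrast

namespace HighContrast

/-! ### Signed measures with a density -/

/-- The space `C_c(U)` of continuous functions with compact support contained in `U`, extended by
zero to the whole space. -/
def compactlySupported (U : Set E3) : Submodule ℝ (E3 → ℝ) where
  carrier := {φ | Continuous φ ∧ HasCompactSupport φ ∧ tsupport φ ⊆ U}
  add_mem' := by
    rintro φ ψ ⟨h1, h2, h3⟩ ⟨h4, h5, h6⟩
    exact ⟨h1.add h4, h2.add h5, (tsupport_add φ ψ).trans (union_subset h3 h6)⟩
  zero_mem' := ⟨continuous_const, HasCompactSupport.zero, by simp [tsupport]⟩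
  smul_mem' := by
    rintro c φ ⟨h1, h2, h3⟩
    exact ⟨h1.const_smul c, h2.smul_left (f := fun _ => c),
      (closure_mono (Function.support_const_smul_subset c φ)).trans h3⟩

theorem IsTestFunction.mem_compactlySupported {U : Set E3} {φ : E3 → ℝ} (h : IsTestFunction U φ) :
    φ ∈ compactlySupported U :=
  ⟨h.1.continuous, h.2⟩

theorem mul_mem_compactlySupported {U : Set E3} {φ ψ : E3 → ℝ} (h : φ ∈ compactlySupported U)
    (hψ : Continuous ψ) : (fun x => φ x * ψ x) ∈ compactlySupported U :=
  ⟨h.1.mul hψ, h.2.1.mul_right, (tsupport_mul_subset_left (f := φ) (g := ψ)).trans h.2.2⟩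

theorem comp_mem_compactlySupported {U : Set E3} {φ : E3 → ℝ} (h : φ ∈ compactlySupported U)
    {f : ℝ → ℝ} (hf : Continuous f) (hf0 : f 0 = 0) :
    (fun x => f (φ x)) ∈ compactlySupported U :=
  ⟨hf.comp h.1, h.2.1.comp_left hf0,
    (closure_mono (Function.support_comp_subset hf0 φ)).trans h.2.2⟩

theorem eq_zero_of_mem_compactlySupported {U : Set E3} {φ : E3 → ℝ}
    (h : φ ∈ compactlySupported U) {x : E3} (hx : x ∉ U) : φ x = 0 :=
  image_eq_zero_of_notMem_tsupport fun hx' => hx (h.2.2 hx')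

theorem isC0_of_mem_compactlySupported {U : Set E3} (hU : IsOpen U) {φ : E3 → ℝ}
    (h : φ ∈ compactlySupported U) : IsC0 U φ :=
  ⟨h.1.continuousOn, fun x hx => eq_zero_of_mem_compactlySupported h
    (by rw [hU.frontier_eq] at hx; exact hx.2)⟩

theorem memLp_of_mem_compactlySupported {U : Set E3} {φ : E3 → ℝ}
    (h : φ ∈ compactlySupported U) (p : ℝ≥0∞) (V : Set E3) : MemLp φ p (volume.restrict V) :=
  (h.1.memLp_of_hasCompactSupport h.2.1).restrict V

theorem integrable_of_mem_compactlySupported {U : Set E3} {φ : E3 → ℝ}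
    (h : φ ∈ compactlySupported U) (μ : Measure E3) [IsFiniteMeasure μ] : Integrable φ μ :=
  h.1.integrable_of_hasCompactSupport h.2.1

/-- Bounded open sets have continuous cutoff functions that converge to `1` inside the set. -/
theorem exists_cutoff {U : Set E3} (hU : IsOpen U) (hUb : Bornology.IsBounded U) :
    ∃ χ : ℕ → E3 → ℝ, (∀ j, χ j ∈ compactlySupported U) ∧ (∀ j x, |χ j x| ≤ 1) ∧
      ∀ x ∈ U, Tendsto (fun j => χ j x) atTop (𝓝 1) := by
  have hne : (Uᶜ).Nonempty := by
    rw [nonempty_compl]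
    rintro rfl
    exact NormedSpace.unbounded_univ ℝ E3 hUb
  let χ : ℕ → E3 → ℝ := fun j x => max 0 (min 1 (j * Metric.infDist x Uᶜ - 1))
  have hχc : ∀ j, Continuous (χ j) := fun j => by
    have := Metric.continuous_infDist_pt Uᶜ
    fun_prop
  have hsupp : ∀ j, tsupport (χ j) ⊆ U := by
    intro j
    have h1 : tsupport (χ j) ⊆ {x | 1 ≤ j * Metric.infDist x Uᶜ} := by
      refine closure_minimal (fun x hx => ?_) (isClosed_le continuous_const
        (continuous_const.mul (Metric.continuous_infDist_pt _)))
      by_contra h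
      simp only [mem_ofPred_eq, not_le] at h
      refine hx (max_eq_left (min_le_iff.2 (Or.inr ?_)))
      linarith
    intro x hx
    by_contra h
    have := h1 hx
    simp only [mem_ofPred_eq] at this
    rw [Metric.infDist_zero_of_mem h] at this
    norm_num at this
  refine ⟨χ, fun j => ⟨hχc j, ?_, hsupp j⟩, fun j x => ?_, fun x hx => ?_⟩
  · exact Metric.isCompact_of_isClosed_isBounded (isClosed_tsupport _) (hUb.subset (hsupp j))
  · rw [abs_of_nonneg (le_max_left _ _)]
    exact max_le zero_le_one (min_le_left _ _)
  · have hd : 0 < Metric.infDist x Uᶜ :=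
      (hU.isClosed_compl.notMem_iff_infDist_pos hne).1 (by simpa using hx)
    have h1 : Tendsto (fun j : ℕ => (j : ℝ) * Metric.infDist x Uᶜ) atTop atTop :=
      tendsto_natCast_atTop_atTop.atTop_mul_const hd
    refine tendsto_const_nhds.congr' ?_
    filter_upwards [h1.eventually_ge_atTop 2] with j hj
    simp only [χ]
    rw [min_eq_left (by linarith), max_eq_right zero_le_one]

/-- Finite measures carried by a bounded open set `U` are determined by their integrals
against `C_c(U)`. -/
theorem ext_of_forall_integral_compactlySupported {U : Set E3} (hU : IsOpen U)
    (hUb : Bornology.IsBounded U) {μ ν : Measure E3} [IsFiniteMeasure μ] [IsFiniteMeasure ν]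
    (hμ : μ Uᶜ = 0) (hν : ν Uᶜ = 0)
    (h : ∀ φ ∈ compactlySupported U, ∫ x, φ x ∂μ = ∫ x, φ x ∂ν) : μ = ν := by
  obtain ⟨χ, hχ, hχ1, hχt⟩ := exists_cutoff hU hUb
  refine ext_of_forall_integral_eq_of_IsFiniteMeasure fun f => ?_
  have key : ∀ (ρ : Measure E3) [IsFiniteMeasure ρ], ρ Uᶜ = 0 →
      Tendsto (fun j => ∫ x, χ j x * f x ∂ρ) atTop (𝓝 (∫ x, f x ∂ρ)) := by
    intro ρ _ hρ
    refine tendsto_integral_of_dominated_convergence (fun _ => ‖f‖)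
      (fun j => ((hχ j).1.mul f.continuous).aestronglyMeasurable) (integrable_const _)
      (fun j => Eventually.of_forall fun x => ?_) ?_
    · rw [norm_mul]
      exact (mul_le_of_le_one_left (norm_nonneg _) (hχ1 j x)).trans (f.norm_coe_le_norm x)
    · have hU' : ∀ᵐ x ∂ρ, x ∈ U := hρ
      filter_upwards [hU'] with x hx
      simpa using (hχt x hx).mul_const (f x)
  refine tendsto_nhds_unique (key μ hμ) ((key ν hν).congr fun j => ?_)
  exact (h _ (mul_mem_compactlySupported (hχ j) f.continuous)).symm

/-- A signed measure whose integrals against `C_c(U)` are those of an integrable function `g`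
has density `g` on `U`. -/
theorem restrict_eq_withDensity_of_signedIntegral_eq {U : Set E3} (hU : IsOpen U)
    (hUb : Bornology.IsBounded U) {μ : SignedMeasure E3} {g : E3 → ℝ}
    (hg : Integrable g (volume.restrict U))
    (h : ∀ φ ∈ compactlySupported U, signedIntegral U μ φ = ∫ x in U, φ x * g x) :
    μ.restrict U = (volume.restrict U).withDensityᵥ g := by
  have hgn : Integrable (fun x => -g x) (volume.restrict U) := hg.neg
  set p := μ.toJordanDecomposition.posPart
  set q := μ.toJordanDecomposition.negPart
  let dp := (volume.restrict U).withDensity fun x => ENNReal.ofReal (g x)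
  let dq := (volume.restrict U).withDensity fun x => ENNReal.ofReal (-g x)
  have hdp : IsFiniteMeasure dp := isFiniteMeasure_withDensity_ofReal hg.2
  have hdq : IsFiniteMeasure dq := isFiniteMeasure_withDensity_ofReal hgn.2
  have hint : ∀ φ ∈ compactlySupported U,
      (∫ x, φ x ∂dp) - ∫ x, φ x ∂dq = ∫ x in U, φ x * g x := by
    intro φ hφ
    obtain ⟨C, hC⟩ := hφ.2.1.exists_bound_of_continuous hφ.1
    have hmul : ∀ {f : E3 → ℝ}, IntegrableOn f U → IntegrableOn (fun x => f x * φ x) U :=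
      fun hf => Integrable.mul_bdd (c := C) hf hφ.1.aestronglyMeasurable (Eventually.of_forall hC)
    simp only [dp, dq]
    rw [integral_withDensity_eq_integral_toReal_smul₀ hg.1.aemeasurable.ennreal_ofReal
        (by simp), integral_withDensity_eq_integral_toReal_smul₀
        hgn.1.aemeasurable.ennreal_ofReal (by simp)]
    simp only [ENNReal.toReal_ofReal', smul_eq_mul]
    rw [← integral_sub (hmul hg.pos_part) (hmul hg.neg_part)]
    refine integral_congr_ae (Eventually.of_forall fun x => ?_)
    simp only
    rcases le_total 0 (g x) with h0 | h0
    · rw [max_eq_left h0, max_eq_right (by linarith)]; ring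
    · rw [max_eq_right h0, max_eq_left (by linarith)]; ring
  -- `p - q = g⁺ - g⁻` on `U`, rearranged into an equality of positive measures
  have heq : p.restrict U + dq = q.restrict U + dp := by
    have hd : ∀ f : E3 → ℝ≥0∞, (volume.restrict U).withDensity f Uᶜ = 0 := fun f =>
      withDensity_absolutelyContinuous _ _ (by simp [Measure.restrict_apply,
        hU.measurableSet.compl])
    refine ext_of_forall_integral_compactlySupported hU hUb ?_ ?_ fun φ hφ => ?_
    · simp [Measure.restrict_apply hU.measurableSet.compl, dq, hd]
    · simp [Measure.restrict_apply hU.measurableSet.compl, dp, hd]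
    · rw [integral_add_measure (integrable_of_mem_compactlySupported hφ _)
        (integrable_of_mem_compactlySupported hφ _),
        integral_add_measure (integrable_of_mem_compactlySupported hφ _)
        (integrable_of_mem_compactlySupported hφ _)]
      have h1 := h φ hφ
      rw [← hint φ hφ] at h1
      simp only [signedIntegral] at h1
      linarith
  ext E hE
  have h1 : (p.restrict U + dq).real E = (q.restrict U + dp).real E := by rw [heq]
  rw [measureReal_add_apply, measureReal_add_apply, measureReal_restrict_apply hE,
    measureReal_restrict_apply hE] at h1
  have h2 : (volume.restrict U).withDensityᵥ g E = dp.real E - dq.real E := by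
    rw [withDensityᵥ_eq_withDensity_pos_part_sub_withDensity_neg_part hg, _root_.sub_apply,
      Measure.toSignedMeasure_apply_measurable hE, Measure.toSignedMeasure_apply_measurable hE]
  rw [h2, VectorMeasure.restrict_apply _ hU.measurableSet hE,
    μ.apply_eq_posPart_real_sub_negPart_real (hE.inter hU.measurableSet)]
  linarith

/-- A signed measure that is bounded on `C_c(U)` for the norm of `L²(U)` has a density in `L²(U)`,
by the Riesz representation theorem in `L²(U)`. -/
theorem exists_isLpDensity_two {U : Set E3} (hU : IsOpen U) (hUb : Bornology.IsBounded U)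
    {μ : SignedMeasure E3} {C : ℝ}
    (h : ∀ φ ∈ compactlySupported U, |signedIntegral U μ φ| ≤ C * √(∫ x in U, φ x ^ 2)) :
    ∃ g, IsLpDensity U μ 2 g ∧
      ∀ φ ∈ compactlySupported U, signedIntegral U μ φ = ∫ x in U, φ x * g x := by
  have : IsFiniteMeasure (volume.restrict U : Measure E3) :=
    ⟨by simpa using hUb.measure_lt_top⟩
  let ι : compactlySupported U →ₗ[ℝ] Lp ℝ 2 (volume.restrict U : Measure E3) :=
    { toFun := fun φ => (memLp_of_mem_compactlySupported φ.2 2 U).toLp φ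
      map_add' := fun φ ψ => MemLp.toLp_add _ _
      map_smul' := fun c φ => MemLp.toLp_const_smul _ _ }
  let L : compactlySupported U →ₗ[ℝ] ℝ :=
    { toFun := fun φ => signedIntegral U μ φ
      map_add' := fun φ ψ => by
        simp only [signedIntegral, Submodule.coe_add, Pi.add_apply]
        rw [integral_add (integrable_of_mem_compactlySupported φ.2 _)
          (integrable_of_mem_compactlySupported ψ.2 _),
          integral_add (integrable_of_mem_compactlySupported φ.2 _)
          (integrable_of_mem_compactlySupported ψ.2 _)]
        ring
      map_smul' := fun c φ => by
        simp only [signedIntegral, Submodule.coe_smul, Pi.smul_apply, smul_eq_mul,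
          integral_const_mul, RingHom.id_apply]
        ring }
  have hι : DenseRange ι := (testLp_dense hU).mono (by
    rintro f ⟨φ, hφ, hf⟩
    exact ⟨⟨φ, hφ.mem_compactlySupported⟩, Lp.ext
      ((memLp_of_mem_compactlySupported hφ.mem_compactlySupported 2 U).coeFn_toLp.trans hf.symm)⟩)
  have hL : ∀ φ, ‖L φ‖ ≤ C * ‖ι φ‖ := fun φ => by
    have e : ‖ι φ‖ = √(∫ x in U, (φ : E3 → ℝ) x ^ 2) := by
      refine (norm_toLp_eq_sqrt (memLp_of_mem_compactlySupported φ.2 2 U)).trans ?_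
      simp
    rw [e]
    exact h φ φ.2
  let g := (InnerProductSpace.toDual ℝ _).symm (L.extendOfNorm ι)
  have hg : MemLp g 2 (volume.restrict U) := Lp.memLp g
  have key : ∀ φ ∈ compactlySupported U, signedIntegral U μ φ = ∫ x in U, φ x * g x := by
    intro φ hφ
    have h1 : L.extendOfNorm ι (ι ⟨φ, hφ⟩) = L ⟨φ, hφ⟩ :=
      LinearMap.extendOfNorm_eq hι ⟨C, hL⟩ _
    have h2 : inner ℝ g (ι ⟨φ, hφ⟩) = L.extendOfNorm ι (ι ⟨φ, hφ⟩) :=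
      InnerProductSpace.toDual_symm_apply
    calc signedIntegral U μ φ = inner ℝ g (ι ⟨φ, hφ⟩) := (h2.trans h1).symm
      _ = inner ℝ (hg.toLp g) ((memLp_of_mem_compactlySupported hφ 2 U).toLp φ) := by
          rw [Lp.toLp_coeFn]; rfl
      _ = _ := by rw [inner_toLp]; simp
  exact ⟨g, ⟨hg, restrict_eq_withDensity_of_signedIntegral_eq hU hUb
    (hg.integrable (by norm_num)) key⟩, key⟩

/-- A signed measure that is bounded on `C_c(U)` for the norm of `L¹(U)` has a density
in `L^∞(U)`. -/
theorem exists_isLpDensity_top {U : Set E3} (hU : IsOpen U) (hUb : Bornology.IsBounded U)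
    {μ : SignedMeasure E3} {C : ℝ} (hC : 0 ≤ C)
    (h : ∀ φ ∈ compactlySupported U, |signedIntegral U μ φ| ≤ C * ∫ x in U, |φ x|) :
    ∃ g, IsLpDensity U μ ⊤ g := by
  have : IsFiniteMeasure (volume.restrict U : Measure E3) :=
    ⟨by simpa using hUb.measure_lt_top⟩
  have hL1 : ∀ f : E3 → ℝ, MemLp f 2 (volume.restrict U) →
      ∫ x in U, |f x| ≤ √(volume.real U) * √(∫ x in U, f x ^ 2) := by
    intro f hf
    have h0 : 0 ≤ ∫ x in U, |f x| := integral_nonneg fun x => abs_nonneg _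
    have h1 := abs_integral_mul_le (memLp_const (1 : ℝ)) hf.abs
    simpa [abs_of_nonneg h0] using h1
  obtain ⟨g, ⟨hg2, hμ⟩, hgφ⟩ := exists_isLpDensity_two hU hUb (μ := μ)
    (C := C * √(volume.real U)) fun φ hφ => by
      rw [mul_assoc]
      exact (h φ hφ).trans (by gcongr; exact hL1 φ (memLp_of_mem_compactlySupported hφ 2 U))
  have hgi : IntegrableOn g U := hg2.integrable (by norm_num)
  -- the bound extends from `C_c(U)` to `L²(U)` by density, in particular to indicator functions
  have hb : ∀ f : E3 → ℝ, MemLp f 2 (volume.restrict U) →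
      |∫ x in U, f x * g x| ≤ C * ∫ x in U, |f x| := by
    intro f hf
    refine le_of_forall_pos_le_add fun e he => ?_
    let D := √(∫ x in U, g x ^ 2) + C * √(volume.real U) + 1
    have hD : 0 < D := by positivity
    obtain ⟨φ, hφ, hfφ⟩ := exists_testFunction_integral_sub_sq_lt hU hf
      (show 0 < (e / D) ^ 2 by positivity)
    have hm := hφ.memLp 2 U
    have hfm : MemLp (fun x => f x - φ x) 2 (volume.restrict U) := hf.sub hm
    have hd : √(∫ x in U, (f x - φ x) ^ 2) ≤ e / D := by
      rw [← Real.sqrt_sq (show 0 ≤ e / D by positivity)]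
      exact Real.sqrt_le_sqrt hfφ.le
    have h1 := h φ hφ.mem_compactlySupported
    rw [hgφ φ hφ.mem_compactlySupported] at h1
    have h2 := abs_integral_mul_le hfm hg2
    have h3 := hL1 _ hfm
    have e1 : ∫ x in U, f x * g x = (∫ x in U, (f x - φ x) * g x) + ∫ x in U, φ x * g x := by
      rw [← integral_add (integrable_mul_of_memLp_two hfm hg2)
        (integrable_mul_of_memLp_two hm hg2)]
      congr 1; ext x; ring
    have e2 : ∫ x in U, |φ x| ≤ (∫ x in U, |f x|) + ∫ x in U, |f x - φ x| := by
      have hi1 : IntegrableOn (fun x => |f x|) U := (hf.integrable (by norm_num)).abs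
      have hi2 : IntegrableOn (fun x => |f x - φ x|) U :=
        (hfm.integrable (by norm_num)).abs
      rw [← integral_add hi1 hi2]
      refine integral_mono (hm.integrable (by norm_num)).abs (hi1.add hi2) fun x => ?_
      have := abs_sub_abs_le_abs_sub (φ x) (f x)
      rw [abs_sub_comm] at this
      simp only
      linarith
    have e3 : √(∫ x in U, (f x - φ x) ^ 2) * √(∫ x in U, g x ^ 2) +
        C * (√(volume.real U) * √(∫ x in U, (f x - φ x) ^ 2)) ≤ e := by
      calc _ = √(∫ x in U, (f x - φ x) ^ 2) * (D - 1) := by simp only [D]; ring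
        _ ≤ e / D * D := by
            have : 0 ≤ C * √(volume.real U) := by positivity
            gcongr
            · simp only [D]; linarith [Real.sqrt_nonneg (∫ x in U, g x ^ 2)]
            · linarith
        _ = e := by field_simp
    calc |∫ x in U, f x * g x|
        ≤ |∫ x in U, (f x - φ x) * g x| + |∫ x in U, φ x * g x| := by rw [e1]; exact abs_add_le _ _
      _ ≤ √(∫ x in U, (f x - φ x) ^ 2) * √(∫ x in U, g x ^ 2) + C * ((∫ x in U, |f x|) +
          √(volume.real U) * √(∫ x in U, (f x - φ x) ^ 2)) := by
          gcongr
          refine h1.trans ?_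
          gcongr
          linarith
      _ ≤ C * (∫ x in U, |f x|) + e := by linarith
  have hset : ∀ s, MeasurableSet s → |∫ x in s, g x ∂volume.restrict U| ≤
      ∫ _ in s, C ∂volume.restrict U := by
    intro s hs
    have h1 := hb (s.indicator fun _ => 1) ((memLp_const 1).indicator hs)
    have e1 : ∀ x, s.indicator (fun _ => (1 : ℝ)) x * g x = s.indicator g x := fun x => by
      by_cases hx : x ∈ s <;> simp [hx]
    have e2 : ∀ x, |s.indicator (fun _ => (1 : ℝ)) x| = s.indicator (fun _ => (1 : ℝ)) x :=
      fun x => abs_of_nonneg (indicator_nonneg (fun _ _ => zero_le_one) x)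
    simp only [e1, e2] at h1
    rw [integral_indicator hs, integral_indicator hs] at h1
    simpa [mul_comm] using h1
  have hle : g ≤ᵐ[volume.restrict U] fun _ => C :=
    ae_le_of_forall_setIntegral_le hgi (integrable_const _) fun s hs _ =>
      (le_abs_self _).trans (hset s hs)
  have hge : (fun x => -g x) ≤ᵐ[volume.restrict U] fun _ => C :=
    ae_le_of_forall_setIntegral_le hgi.neg (integrable_const _) fun s hs _ => by
      rw [integral_neg]
      exact (neg_le_abs _).trans (hset s hs)
  refine ⟨g, memLp_top_of_bound hg2.1 C ?_, hμ⟩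
  filter_upwards [hle, hge] with x h1 h2
  rw [Real.norm_eq_abs]
  exact abs_le.2 ⟨by linarith, h1⟩

end HighContrast

namespace HighContrast

/-! ### Decomposition into cells -/

theorem isOpen_cell (ε : ℝ) (k : Fin 3 → ℤ) : IsOpen (cell ε k) := by
  have : cell ε k = ⋂ i, {x : E3 | ε * ((k i : ℝ) - 1 / 2) < x i} ∩
      {x : E3 | x i < ε * ((k i : ℝ) + 1 / 2)} := by
    ext x; simp [cell]
  rw [this]
  exact isOpen_iInter_of_finite fun i => (isOpen_lt (by fun_prop) (by fun_prop)).inter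
    (isOpen_lt (by fun_prop) (by fun_prop))

theorem cell_nonempty {ε : ℝ} (hε : 0 < ε) (k : Fin 3 → ℤ) : (cell ε k).Nonempty := by
  refine ⟨WithLp.toLp 2 fun i => ε * k i, fun i => ?_⟩
  constructor <;> simp only <;> gcongr <;> linarith

theorem dist_le_of_mem_cell {ε : ℝ} (hε : 0 < ε) {k : Fin 3 → ℤ} {x y : E3} (hx : x ∈ cell ε k)
    (hy : y ∈ cell ε k) : dist x y ≤ 2 * ε := by
  have h : ∀ i, dist (x i) (y i) ^ 2 ≤ ε ^ 2 := fun i => by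
    have h1 := hx i
    have h2 := hy i
    rw [Real.dist_eq, sq_abs]
    apply sq_le_sq'
    · nlinarith [h1.1, h2.2]
    · nlinarith [h1.2, h2.1]
  rw [EuclideanSpace.dist_eq]
  apply Real.sqrt_le_iff.2 ⟨by positivity, ?_⟩
  calc ∑ i, dist (x i) (y i) ^ 2 ≤ ∑ i : Fin 3, ε ^ 2 := Finset.sum_le_sum fun i _ => h i
    _ ≤ (2 * ε) ^ 2 := by simp; nlinarith [sq_nonneg ε]

theorem isBounded_cell {ε : ℝ} (hε : 0 < ε) (k : Fin 3 → ℤ) : Bornology.IsBounded (cell ε k) :=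
  Metric.isBounded_iff.2 ⟨2 * ε, fun _ hx _ hy => dist_le_of_mem_cell hε hx hy⟩

theorem pairwise_disjoint_cell {ε : ℝ} (hε : 0 < ε) :
    Pairwise fun k l => Disjoint (cell ε k) (cell ε l) := by
  intro k l hkl
  rw [Set.disjoint_left]
  intro x hk hl
  apply hkl
  ext i
  have h1 : (k i : ℝ) - 1 / 2 < l i + 1 / 2 :=
    lt_of_mul_lt_mul_left ((hk i).1.trans (hl i).2) hε.le
  have h2 : (l i : ℝ) - 1 / 2 < k i + 1 / 2 :=
    lt_of_mul_lt_mul_left ((hl i).1.trans (hk i).2) hε.le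
  have h3 : (k i : ℝ) < ((l i + 1 : ℤ) : ℝ) := by push_cast; linarith
  have h4 : (l i : ℝ) < ((k i + 1 : ℤ) : ℝ) := by push_cast; linarith
  have h5 := Int.cast_lt.1 h3
  have h6 := Int.cast_lt.1 h4
  omega

/-- The cells cover the space up to a null set, the union of the hyperplanes that carry
their faces. -/
theorem ae_exists_mem_cell {ε : ℝ} (hε : 0 < ε) : ∀ᵐ x : E3, ∃ k, x ∈ cell ε k := by
  have hnull : ∀ (i : Fin 3) (c : ℝ), ∀ᵐ x : E3, x i ≠ c := by
    intro i c
    have h1 : ∀ᵐ x : Fin 3 → ℝ, x i ≠ c := by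
      rw [volume_pi]
      exact Measure.ae_eval_ne (fun _ : Fin 3 => (volume : Measure ℝ)) i c
    exact (EuclideanSpace.volume_preserving_symm_measurableEquiv_toLp
      (Fin 3)).quasiMeasurePreserving.ae h1
  have h : ∀ᵐ x : E3, ∀ (i : Fin 3) (m : ℤ), x i ≠ ε * ((m : ℝ) + 1 / 2) :=
    ae_all_iff.2 fun i => ae_all_iff.2 fun m => hnull i _
  filter_upwards [h] with x hx
  refine ⟨fun i => ⌈x i / ε - 1 / 2⌉, fun i => ?_⟩
  have h1 := Int.le_ceil (x i / ε - 1 / 2)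
  have h2 := Int.ceil_lt_add_one (x i / ε - 1 / 2)
  have h3 : ε * (x i / ε) = x i := by field_simp
  constructor
  · calc ε * ((⌈x i / ε - 1 / 2⌉ : ℝ) - 1 / 2) < ε * (x i / ε) := by gcongr; linarith
      _ = x i := h3
  · refine lt_of_le_of_ne ?_ (hx i _)
    calc x i = ε * (x i / ε) := h3.symm
      _ ≤ ε * ((⌈x i / ε - 1 / 2⌉ : ℝ) + 1 / 2) := by gcongr; linarith

/-- An inequality between integrals over the cells contained in `U` sums up to an inequality
between integrals over `K` and `U`, if all cells that meet `K` are contained in `U`. -/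
theorem setLIntegral_le_of_forall_cell {ε : ℝ} (hε : 0 < ε) {K U : Set E3}
    (hKU : ∀ k, (cell ε k ∩ K).Nonempty → cell ε k ⊆ U) {f g : E3 → ℝ≥0∞}
    (h : ∀ k, cell ε k ⊆ U → ∫⁻ x in cell ε k, f x ≤ ∫⁻ x in cell ε k, g x) :
    ∫⁻ x in K, f x ≤ ∫⁻ x in U, g x := by
  let S := {k // cell ε k ⊆ U}
  have hd : Pairwise (Function.onFun Disjoint fun k : S => cell ε k) := fun k l hkl =>
    pairwise_disjoint_cell hε fun h => hkl (Subtype.ext h)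
  have hm : ∀ k : S, MeasurableSet (cell ε k) := fun k => (isOpen_cell ε k).measurableSet
  have hcover : K ≤ᵐ[volume] ⋃ k : S, cell ε k := by
    filter_upwards [ae_exists_mem_cell hε] with x ⟨k, hk⟩ hx
    exact mem_iUnion.2 ⟨⟨k, hKU k ⟨x, hk, hx⟩⟩, hk⟩
  calc ∫⁻ x in K, f x ≤ ∫⁻ x in ⋃ k : S, cell ε k, f x :=
        lintegral_mono' (Measure.restrict_mono' hcover le_rfl) le_rfl
    _ = ∑' k : S, ∫⁻ x in cell ε k, f x := lintegral_iUnion hm hd _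
    _ ≤ ∑' k : S, ∫⁻ x in cell ε k, g x := ENNReal.tsum_le_tsum fun k => h k k.2
    _ = ∫⁻ x in ⋃ k : S, cell ε k, g x := (lintegral_iUnion hm hd _).symm
    _ ≤ ∫⁻ x in U, g x := lintegral_mono_set (iUnion_subset fun k => k.2)

theorem setIntegral_le_of_forall_cell {ε : ℝ} (hε : 0 < ε) {K U : Set E3}
    (hK : MeasurableSet K) (hKU : ∀ k, (cell ε k ∩ K).Nonempty → cell ε k ⊆ U) {f g : E3 → ℝ}
    (hf0 : ∀ x ∈ U, 0 ≤ f x) (hg0 : ∀ x ∈ U, 0 ≤ g x) (hU : MeasurableSet U) (hKU' : K ⊆ U)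
    (hf : IntegrableOn f U) (hg : IntegrableOn g U)
    (h : ∀ k, cell ε k ⊆ U → ∫ x in cell ε k, f x ≤ ∫ x in cell ε k, g x) :
    ∫ x in K, f x ≤ ∫ x in U, g x := by
  have key : ∀ {f : E3 → ℝ} {s : Set E3}, (∀ x ∈ U, 0 ≤ f x) → IntegrableOn f U →
      MeasurableSet s → s ⊆ U → ∫⁻ x in s, ENNReal.ofReal (f x) =
        ENNReal.ofReal (∫ x in s, f x) := fun h0 hi hs hsU =>
    (ofReal_integral_eq_lintegral_ofReal (hi.mono_set hsU)
      ((ae_restrict_iff' hs).2 (Eventually.of_forall fun x hx => h0 x (hsU hx)))).symm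
  have h1 := setLIntegral_le_of_forall_cell hε hKU (f := fun x => ENNReal.ofReal (f x))
    (g := fun x => ENNReal.ofReal (g x)) fun k hk => by
      have hm := (isOpen_cell ε k).measurableSet
      rw [key hf0 hf hm hk, key hg0 hg hm hk]
      exact ENNReal.ofReal_le_ofReal (h k hk)
  rw [key hf0 hf hK hKU', key hg0 hg hU subset_rfl] at h1
  exact (ENNReal.ofReal_le_ofReal_iff (setIntegral_nonneg hU hg0)).1 h1

/-- The Cauchy–Schwarz inequality for averages. -/
theorem sq_setAverage_mul_le {Q : Set E3} (hQ : volume Q ≠ ⊤) {f : E3 → ℝ}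
    (hf : MemLp f 2 (volume.restrict Q)) :
    (⨍ x in Q, f x) ^ 2 * volume.real Q ≤ ∫ x in Q, f x ^ 2 := by
  have : IsFiniteMeasure (volume.restrict Q : Measure E3) := ⟨by simpa using hQ.lt_top⟩
  rcases eq_or_ne (volume.real Q) 0 with h0 | h0
  · rw [h0, mul_zero]
    exact integral_nonneg fun x => sq_nonneg _
  set a := ⨍ x in Q, f x with ha
  have hfi : Integrable f (volume.restrict Q) := hf.integrable (by norm_num)
  have hfa : ∫ x in Q, f x = a * volume.real Q := by
    rw [ha, setAverage_eq, smul_eq_mul]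
    field_simp
  have h1 : 0 ≤ ∫ x in Q, (f x - a) ^ 2 := integral_nonneg fun x => sq_nonneg _
  have e : ∀ x, (f x - a) ^ 2 = f x ^ 2 - 2 * a * f x + a ^ 2 := fun x => by ring
  simp only [e] at h1
  have hi := hfi.const_mul (2 * a)
  have hi' : Integrable (fun x => f x ^ 2 - 2 * a * f x) (volume.restrict Q) :=
    hf.integrable_sq.sub hi
  rw [integral_add hi' (integrable_const _), integral_sub hf.integrable_sq hi, integral_const_mul,
    hfa] at h1
  simp at h1
  linarith

end HighContrast

namespace HighContrast

/-! ### The weighted energy estimate -/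

theorem integrable_bdd_mul_sq {F : Type*} [NormedAddCommGroup F] {s : Set E3}
    (hs : MeasurableSet s) {a : E3 → ℝ} (ha : Measurable a) {L : ℝ}
    (h0 : ∀ x ∈ s, 0 ≤ a x) (hL : ∀ x ∈ s, a x ≤ L) {f : E3 → F}
    (hf : MemLp f 2 (volume.restrict s)) :
    Integrable (fun x => a x * ‖f x‖ ^ 2) (volume.restrict s) :=
  hf.integrable_norm_pow (by norm_num) |>.bdd_mul (c := L) ha.aestronglyMeasurable
    ((ae_restrict_iff' hs).2 (Eventually.of_forall fun x hx => by
      rw [Real.norm_of_nonneg (h0 x hx)]; exact hL x hx))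

/-- The estimate on one cell `Q`: the difference `v - ψ` is the sum of `v - ⨍ v`, controlled by the
weighted Poincaré–Wirtinger inequality, of the constant `⨍ (v - ψ)`, controlled by the average of
the weight, and of `⨍ ψ - ψ`, controlled by the oscillation of `ψ`. -/
theorem setIntegral_weight_mul_sub_sq_le {Q : Set E3} (hQ : IsOpen Q) (hQne : Q.Nonempty)
    (hQb : Bornology.IsBounded Q) {a : E3 → ℝ} (ha : Measurable a) {L c A η : ℝ}
    (h0 : ∀ x ∈ Q, 0 ≤ a x) (hL : ∀ x ∈ Q, a x ≤ L) (hPW : WeightedPoincareWirtinger Q a c)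
    (hA : ⨍ x in Q, a x ≤ A) {v ψ : E3 → ℝ} {G : E3 → E3} (hv : IsH1 Q v G)
    (hψ : MemLp ψ 2 (volume.restrict Q)) (hη : ∀ x ∈ Q, ∀ y ∈ Q, dist (ψ y) (ψ x) ≤ η) :
    ∫ x in Q, a x * (v x - ψ x) ^ 2 ≤
      3 * (c * ∫ x in Q, a x * ‖G x‖ ^ 2) + 3 * (A * ∫ x in Q, (v x - ψ x) ^ 2) +
        3 * (η ^ 2 * ∫ x in Q, a x) := by
  have hQF : volume Q ≠ ⊤ := hQb.measure_lt_top.ne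
  have hQ0 : volume Q ≠ 0 := (hQ.measure_pos volume hQne).ne'
  have : IsFiniteMeasure (volume.restrict Q : Measure E3) := ⟨by simpa using hQF.lt_top⟩
  have hQr : 0 < volume.real Q := ENNReal.toReal_pos hQ0 hQF
  set p := ⨍ x in Q, v x
  set q := ⨍ x in Q, ψ x
  have hvψ : MemLp (fun x => v x - ψ x) 2 (volume.restrict Q) := hv.1.sub hψ
  have hvi : Integrable v (volume.restrict Q) := hv.1.integrable (by norm_num)
  have hψi : Integrable ψ (volume.restrict Q) := hψ.integrable (by norm_num)
  have hI : ∀ {f : E3 → ℝ}, MemLp f 2 (volume.restrict Q) →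
      Integrable (fun x => a x * f x ^ 2) (volume.restrict Q) := fun hf => by
    simpa using integrable_bdd_mul_sq hQ.measurableSet ha h0 hL hf
  have hai : Integrable a (volume.restrict Q) := by
    simpa using hI (memLp_const (1 : ℝ))
  have hvp : MemLp (fun x => v x - p) 2 (volume.restrict Q) := hv.1.sub (memLp_const p)
  have hq : ∀ x ∈ Q, (q - ψ x) ^ 2 ≤ η ^ 2 := by
    intro x hx
    have h1 : q ∈ Metric.closedBall (ψ x) η :=
      (convex_closedBall (ψ x) η).set_average_mem Metric.isClosed_closedBall hQ0 hQF
        ((ae_restrict_iff' hQ.measurableSet).2 (Eventually.of_forall fun y hy => hη x hx y hy)) hψi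
    rw [Metric.mem_closedBall, Real.dist_eq] at h1
    exact sq_le_sq.2 (h1.trans (le_abs_self η))
  have hpt : ∀ x ∈ Q, a x * (v x - ψ x) ^ 2 ≤
      3 * (a x * (v x - p) ^ 2) + 3 * ((p - q) ^ 2 * a x) + 3 * (η ^ 2 * a x) := by
    intro x hx
    have h1 : (v x - ψ x) ^ 2 ≤ 3 * (v x - p) ^ 2 + 3 * (p - q) ^ 2 + 3 * η ^ 2 := by
      nlinarith [hq x hx, sq_nonneg ((v x - p) - (p - q)), sq_nonneg ((v x - p) - (q - ψ x)),
        sq_nonneg ((p - q) - (q - ψ x))]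
    calc a x * (v x - ψ x) ^ 2 ≤ a x * (3 * (v x - p) ^ 2 + 3 * (p - q) ^ 2 + 3 * η ^ 2) := by
          gcongr
          exact h0 x hx
      _ = _ := by ring
  have e1 : ∫ x in Q, a x ≤ A * volume.real Q := by
    rw [setAverage_eq, smul_eq_mul, inv_mul_le_iff₀ hQr] at hA
    linarith
  have hA0 : 0 ≤ A := by
    have : 0 ≤ ∫ x in Q, a x := setIntegral_nonneg hQ.measurableSet h0
    by_contra h
    have := mul_neg_of_neg_of_pos (not_le.1 h) hQr
    linarith
  have e2 : (p - q) ^ 2 * volume.real Q ≤ ∫ x in Q, (v x - ψ x) ^ 2 := by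
    have := sq_setAverage_mul_le hQF hvψ
    rwa [setAverage_eq, integral_sub hvi hψi, smul_sub, ← setAverage_eq, ← setAverage_eq] at this
  -- in the constant term, the weight enters only through its average, which is at most `A`
  have e3 : (p - q) ^ 2 * ∫ x in Q, a x ≤ A * ∫ x in Q, (v x - ψ x) ^ 2 := by
    calc (p - q) ^ 2 * ∫ x in Q, a x ≤ (p - q) ^ 2 * (A * volume.real Q) := by gcongr
      _ = A * ((p - q) ^ 2 * volume.real Q) := by ring
      _ ≤ _ := by gcongr
  have i1 : Integrable (fun x => 3 * (a x * (v x - p) ^ 2)) (volume.restrict Q) :=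
    (hI hvp).const_mul 3
  have i2 : Integrable (fun x => 3 * ((p - q) ^ 2 * a x)) (volume.restrict Q) :=
    (hai.const_mul _).const_mul 3
  have i3 : Integrable (fun x => 3 * (η ^ 2 * a x)) (volume.restrict Q) :=
    (hai.const_mul _).const_mul 3
  have i12 : Integrable (fun x => 3 * (a x * (v x - p) ^ 2) + 3 * ((p - q) ^ 2 * a x))
      (volume.restrict Q) := i1.add i2
  have h1 := setIntegral_mono_on (hI hvψ) (i12.add i3) hQ.measurableSet hpt
  simp only [Pi.add_apply] at h1
  rw [integral_add i12 i3, integral_add i1 i2, integral_const_mul, integral_const_mul,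
    integral_const_mul, integral_const_mul, integral_const_mul] at h1
  have h2 := hPW v G hv
  linarith

/-- The properties of the coefficients `αₙ` in a domain `Ω` on which the compactness argument
relies: `αₙ` is positive, it is bounded for each `n` and bounded in `L¹(Ω)` uniformly in `n`, its
averages over the cells of size `εₙ` contained in `Ω` are at most `A`, and the weighted
Poincaré–Wirtinger inequality holds in these cells with constants `cₙ → 0`. -/
structure IsCoefficientFamily (Ω : Set E3) (α : ℕ → E3 → ℝ) (ε c : ℕ → ℝ) (A M : ℝ) : Prop where
  isOpen : IsOpen Ω
  isBounded : Bornology.IsBounded Ω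
  measurable : ∀ n, Measurable (α n)
  pos : ∀ n ⦃x⦄, x ∈ Ω → 0 < α n x
  upper : ∀ n, ∃ L, ∀ x ∈ Ω, α n x ≤ L
  integral_le : ∀ n, ∫ x in Ω, α n x ≤ M
  eps_pos : ∀ n, 0 < ε n
  eps_tendsto : Tendsto ε atTop (𝓝 0)
  c_pos : ∀ n, 0 < c n
  c_tendsto : Tendsto c atTop (𝓝 0)
  poincare : ∀ n k, cell (ε n) k ⊆ Ω → WeightedPoincareWirtinger (cell (ε n) k) (α n) (c n)
  average_le : ∀ n k, cell (ε n) k ⊆ Ω → ⨍ x in cell (ε n) k, α n x ≤ A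
  const_nonneg : 0 ≤ A

namespace IsCoefficientFamily

variable {Ω : Set E3} {α : ℕ → E3 → ℝ} {ε c : ℕ → ℝ} {A M : ℝ}

theorem isFiniteMeasure (h : IsCoefficientFamily Ω α ε c A M) :
    IsFiniteMeasure (volume.restrict Ω : Measure E3) :=
  ⟨by simpa using h.isBounded.measure_lt_top⟩

theorem integrable_mul_norm_sq (h : IsCoefficientFamily Ω α ε c A M) (n : ℕ) {F : Type*}
    [NormedAddCommGroup F] {f : E3 → F} (hf : MemLp f 2 (volume.restrict Ω)) :
    IntegrableOn (fun x => α n x * ‖f x‖ ^ 2) Ω := by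
  obtain ⟨L, hL⟩ := h.upper n
  exact integrable_bdd_mul_sq h.isOpen.measurableSet (h.measurable n)
    (fun x hx => (h.pos n hx).le) hL hf

theorem integrable_mul_sq (h : IsCoefficientFamily Ω α ε c A M) (n : ℕ) {f : E3 → ℝ}
    (hf : MemLp f 2 (volume.restrict Ω)) : IntegrableOn (fun x => α n x * f x ^ 2) Ω := by
  simpa using h.integrable_mul_norm_sq n hf

theorem integrable (h : IsCoefficientFamily Ω α ε c A M) (n : ℕ) : IntegrableOn (α n) Ω := by
  have := h.isFiniteMeasure
  simpa using h.integrable_mul_sq n (memLp_const (1 : ℝ))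

/-- The sum over the cells of `setIntegral_weight_mul_sub_sq_le`. -/
theorem setIntegral_mul_sub_sq_le (h : IsCoefficientFamily Ω α ε c A M) (n : ℕ) {K U : Set E3}
    (hK : MeasurableSet K) (hKU : K ⊆ U) (hU : IsOpen U) (hUΩ : U ⊆ Ω)
    (hcell : ∀ k, (cell (ε n) k ∩ K).Nonempty → cell (ε n) k ⊆ U) {v ψ : E3 → ℝ} {G : E3 → E3}
    (hv : IsH1 Ω v G) (hψ : MemLp ψ 2 (volume.restrict Ω)) {η : ℝ}
    (hη : ∀ x y, dist y x ≤ 2 * ε n → dist (ψ y) (ψ x) ≤ η) :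
    ∫ x in K, α n x * (v x - ψ x) ^ 2 ≤
      3 * (c n * ∫ x in Ω, α n x * ‖G x‖ ^ 2) + 3 * (A * ∫ x in U, (v x - ψ x) ^ 2) +
        3 * (η ^ 2 * M) := by
  have hvψ : MemLp (fun x => v x - ψ x) 2 (volume.restrict Ω) := hv.1.sub hψ
  have hc := (h.c_pos n).le
  have hA := h.const_nonneg
  have i1 : IntegrableOn (fun x => 3 * (c n * (α n x * ‖G x‖ ^ 2))) Ω :=
    ((h.integrable_mul_norm_sq n hv.2.1).const_mul _).const_mul 3
  have i2 : IntegrableOn (fun x => 3 * (A * (v x - ψ x) ^ 2)) Ω :=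
    (hvψ.integrable_sq.const_mul _).const_mul 3
  have i3 : IntegrableOn (fun x => 3 * (η ^ 2 * α n x)) Ω :=
    ((h.integrable n).const_mul _).const_mul 3
  have hsum : ∀ s ⊆ Ω, ∫ x in s, (3 * (c n * (α n x * ‖G x‖ ^ 2)) + 3 * (A * (v x - ψ x) ^ 2) +
      3 * (η ^ 2 * α n x)) = 3 * (c n * ∫ x in s, α n x * ‖G x‖ ^ 2) +
      3 * (A * ∫ x in s, (v x - ψ x) ^ 2) + 3 * (η ^ 2 * ∫ x in s, α n x) := by
    intro s hs
    have j1 := i1.mono_set hs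
    have j2 := i2.mono_set hs
    have j12 : IntegrableOn (fun x => 3 * (c n * (α n x * ‖G x‖ ^ 2)) +
      3 * (A * (v x - ψ x) ^ 2)) s := j1.add j2
    rw [integral_add j12 (i3.mono_set hs), integral_add j1 j2]
    simp only [integral_const_mul]
  obtain ⟨L, hL⟩ := h.upper n
  have hα0 : ∀ x ∈ Ω, 0 ≤ α n x := fun x hx => (h.pos n hx).le
  have key := setIntegral_le_of_forall_cell (h.eps_pos n) hK hcell
    (f := fun x => α n x * (v x - ψ x) ^ 2) (g := fun x => 3 * (c n * (α n x * ‖G x‖ ^ 2)) +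
      3 * (A * (v x - ψ x) ^ 2) + 3 * (η ^ 2 * α n x))
    (fun x hx => mul_nonneg (hα0 x (hUΩ hx)) (sq_nonneg _))
    (fun x hx => by have := hα0 x (hUΩ hx); positivity) hU.measurableSet hKU
    ((h.integrable_mul_sq n hvψ).mono_set hUΩ)
    (((i1.add i2).add i3).mono_set hUΩ) (fun k hk => by
      have hkΩ := hk.trans hUΩ
      rw [hsum _ hkΩ]
      exact setIntegral_weight_mul_sub_sq_le (isOpen_cell _ _) (cell_nonempty (h.eps_pos n) k)
        (isBounded_cell (h.eps_pos n) k) (h.measurable n) (fun x hx => hα0 x (hkΩ hx))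
        (fun x hx => hL x (hkΩ hx)) (h.poincare n k hkΩ) (h.average_le n k hkΩ)
        (hv.mono hkΩ) (hψ.mono_measure (Measure.restrict_mono hkΩ le_rfl))
        fun x hx y hy => hη x y (dist_le_of_mem_cell (h.eps_pos n) hy hx))
  rw [hsum U hUΩ] at key
  refine key.trans ?_
  gcongr
  · exact (ae_restrict_iff' h.isOpen.measurableSet).2 (Eventually.of_forall fun x hx =>
      mul_nonneg (hα0 x hx) (sq_nonneg _))
  · exact h.integrable_mul_norm_sq n hv.2.1
  · refine le_trans ?_ (h.integral_le n)
    exact setIntegral_mono_set (h.integrable n) ((ae_restrict_iff' h.isOpen.measurableSet).2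
      (Eventually.of_forall hα0)) hUΩ.eventuallyLE

/-- If `vₙ` has bounded weighted energy and converges to `v₀` in `L²_loc(Ω)`, then
`∫_K αₙ |vₙ - ψ|²` is asymptotically controlled by the *unweighted* distance of `v₀` to `ψ`. -/
theorem eventually_setIntegral_mul_sub_sq_le (h : IsCoefficientFamily Ω α ε c A M)
    {v : ℕ → E3 → ℝ} {G : ℕ → E3 → E3} {v₀ ψ : E3 → ℝ} (hv : ∀ n, IsH1 Ω (v n) (G n)) {B : ℝ}
    (hB : ∀ n, ∫ x in Ω, α n x * ‖G n x‖ ^ 2 ≤ B) (hv₀ : MemLp v₀ 2 (volume.restrict Ω))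
    (hloc : ∀ K, IsCompact K → K ⊆ Ω →
      Tendsto (fun n => ∫ x in K, (v n x - v₀ x) ^ 2) atTop (𝓝 0))
    (hψ : ψ ∈ compactlySupported Ω) {K : Set E3} (hK : IsCompact K) (hKΩ : K ⊆ Ω) {e : ℝ}
    (he : 0 < e) :
    ∀ᶠ n in atTop, ∫ x in K, α n x * (v n x - ψ x) ^ 2 ≤
      6 * (A * ∫ x in Ω, (v₀ x - ψ x) ^ 2) + e := by
  obtain ⟨r, hr, hrΩ⟩ := hK.exists_cthickening_subset_open h.isOpen hKΩ
  set K' := Metric.cthickening r K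
  have hK' : IsCompact K' := hK.cthickening
  set U := Metric.thickening r K
  have hUK' : U ⊆ K' := Metric.thickening_subset_cthickening r K
  have hUΩ : U ⊆ Ω := hUK'.trans hrΩ
  have hψ2 := memLp_of_mem_compactlySupported hψ 2 Ω
  -- the oscillation `η` of `ψ` in the cells contributes at most `e / 3` to the estimate
  obtain ⟨η, hη0, hη⟩ : ∃ η : ℝ, 0 < η ∧ 3 * (η ^ 2 * M) < e / 3 := by
    have h1 : Tendsto (fun η : ℝ => 3 * (η ^ 2 * M)) (𝓝[>] 0) (𝓝 (3 * (0 ^ 2 * M))) :=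
      (Continuous.tendsto (by fun_prop) 0).mono_left nhdsWithin_le_nhds
    have h2 := h1.eventually_lt_const (u := e / 3) (by simpa using by positivity)
    obtain ⟨η, h3, h4⟩ := (h2.and self_mem_nhdsWithin).exists
    exact ⟨η, h4, h3⟩
  obtain ⟨δ, hδ, hψδ⟩ := Metric.uniformContinuous_iff.1
    (hψ.1.uniformContinuous_of_tendsto_cocompact
      (hψ.2.1.is_zero_at_infty)) η hη0
  have hε : Tendsto (fun n => 2 * ε n) atTop (𝓝 0) := by simpa using h.eps_tendsto.const_mul 2
  have hcB : Tendsto (fun n => 3 * (c n * B)) atTop (𝓝 0) := by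
    simpa using (h.c_tendsto.mul_const B).const_mul 3
  have hvv : Tendsto (fun n => 6 * (A * ∫ x in K', (v n x - v₀ x) ^ 2)) atTop (𝓝 0) := by
    simpa using ((hloc K' hK' hrΩ).const_mul A).const_mul 6
  filter_upwards [hε.eventually_lt_const hδ, hε.eventually_lt_const hr,
    hcB.eventually_lt_const (show 0 < e / 3 by positivity),
    hvv.eventually_lt_const (show 0 < e / 3 by positivity)] with n h1 h2 h3 h4
  have key := h.setIntegral_mul_sub_sq_le n hK.measurableSet
    (Metric.self_subset_thickening hr K) Metric.isOpen_thickening hUΩ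
    (fun k ⟨x, hxk, hxK⟩ y hy => Metric.mem_thickening_iff.2
      ⟨x, hxK, (dist_le_of_mem_cell (h.eps_pos n) hy hxk).trans_lt h2⟩) (hv n) hψ2 (η := η)
    (fun x y hxy => (hψδ (hxy.trans_lt h1)).le)
  have hc := (h.c_pos n).le
  have hA := h.const_nonneg
  have h5 : 3 * (c n * ∫ x in Ω, α n x * ‖G n x‖ ^ 2) ≤ 3 * (c n * B) := by
    gcongr
    exact hB n
  have m1 : MemLp (fun x => v n x - v₀ x) 2 (volume.restrict Ω) := (hv n).1.sub hv₀
  have m2 : MemLp (fun x => v₀ x - ψ x) 2 (volume.restrict Ω) := hv₀.sub hψ2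
  have m3 : MemLp (fun x => v n x - ψ x) 2 (volume.restrict Ω) := (hv n).1.sub hψ2
  have h6 : ∫ x in U, (v n x - ψ x) ^ 2 ≤
      2 * (∫ x in K', (v n x - v₀ x) ^ 2) + 2 * ∫ x in Ω, (v₀ x - ψ x) ^ 2 := by
    have k1 : IntegrableOn (fun x => (v n x - v₀ x) ^ 2) Ω := m1.integrable_sq
    have k2 : IntegrableOn (fun x => (v₀ x - ψ x) ^ 2) Ω := m2.integrable_sq
    have k3 : IntegrableOn (fun x => (v n x - ψ x) ^ 2) Ω := m3.integrable_sq
    have j1 : IntegrableOn (fun x => 2 * (v n x - v₀ x) ^ 2) U :=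
      (k1.mono_set hUΩ).const_mul 2
    have j2 : IntegrableOn (fun x => 2 * (v₀ x - ψ x) ^ 2) U :=
      (k2.mono_set hUΩ).const_mul 2
    have j12 : IntegrableOn (fun x => 2 * (v n x - v₀ x) ^ 2 + 2 * (v₀ x - ψ x) ^ 2) U :=
      j1.add j2
    calc ∫ x in U, (v n x - ψ x) ^ 2
        ≤ ∫ x in U, (2 * (v n x - v₀ x) ^ 2 + 2 * (v₀ x - ψ x) ^ 2) :=
          integral_mono (k3.mono_set hUΩ) j12 fun x => by
            simp only
            nlinarith [sq_nonneg ((v n x - v₀ x) - (v₀ x - ψ x))]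
      _ = 2 * (∫ x in U, (v n x - v₀ x) ^ 2) + 2 * ∫ x in U, (v₀ x - ψ x) ^ 2 := by
          rw [integral_add j1 j2, integral_const_mul, integral_const_mul]
      _ ≤ _ := by
          gcongr ?_ + ?_
          · exact mul_le_mul_of_nonneg_left (setIntegral_mono_set (k1.mono_set hrΩ)
              (Eventually.of_forall fun _ => sq_nonneg _) hUK'.eventuallyLE) (by norm_num)
          · exact mul_le_mul_of_nonneg_left (setIntegral_mono_set k2
              (Eventually.of_forall fun _ => sq_nonneg _) hUΩ.eventuallyLE) (by norm_num)
  have h7 := mul_le_mul_of_nonneg_left h6 hA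
  rw [mul_add] at h7
  linarith

/-- The weights `αₙ` are asymptotically bounded on `C_c(Ω)` by a multiple of Lebesgue measure. -/
theorem eventually_integral_mul_sq_le (h : IsCoefficientFamily Ω α ε c A M) {φ : E3 → ℝ}
    (hφ : φ ∈ compactlySupported Ω) {e : ℝ} (he : 0 < e) :
    ∀ᶠ n in atTop, ∫ x in Ω, α n x * φ x ^ 2 ≤ 6 * (A * ∫ x in Ω, φ x ^ 2) + e := by
  have := h.eventually_setIntegral_mul_sub_sq_le (v := fun _ => 0) (G := fun _ => 0) (v₀ := 0)
    (fun _ => isH1_zero Ω) (B := 0) (fun n => by simp) MemLp.zero (fun K _ _ => by simp) hφ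
    hφ.2.1 hφ.2.2 he
  filter_upwards [this] with n hn
  simp only [Pi.zero_apply, zero_sub, neg_sq] at hn
  refine le_of_eq_of_le ?_ hn
  rw [setIntegral_eq_integral_of_forall_compl_eq_zero (s := Ω) fun x hx => by
      rw [eq_zero_of_mem_compactlySupported hφ hx]; simp,
    setIntegral_eq_integral_of_forall_compl_eq_zero fun x hx => by
      rw [image_eq_zero_of_notMem_tsupport hx]; simp]

end IsCoefficientFamily

end HighContrast

namespace HighContrast

/-! ### Weak-* compactness and weak-* limits -/

theorem signedIntegral_toSignedMeasure (U : Set E3) (ν : Measure E3) [IsFiniteMeasure ν]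
    (φ : E3 → ℝ) : signedIntegral U ν.toSignedMeasure φ = ∫ x in U, φ x ∂ν := by
  let j : JordanDecomposition E3 :=
    { posPart := ν
      negPart := 0
      mutuallySingular := Measure.MutuallySingular.zero_right }
  have h : ν.toSignedMeasure = j.toSignedMeasure := by
    simp [j, JordanDecomposition.toSignedMeasure]
  rw [signedIntegral, SignedMeasure.toJordanDecomposition_eq h]
  simp [j]

/-- Sequences of nonnegative functions that are bounded in `L¹(U)` are weakly-* relatively compact:
Prokhorov's theorem applies to the normalized densities, all carried by the compact closure
of `U`. -/
theorem exists_weakStarTendsto_subseq {U : Set E3} (hU : IsOpen U) (hUb : Bornology.IsBounded U)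
    {f : ℕ → E3 → ℝ} (hf : ∀ n, IntegrableOn (f n) U) (hf0 : ∀ n, ∀ x ∈ U, 0 ≤ f n x) {M : ℝ}
    (hpos : ∀ n, 0 < ∫ x in U, f n x) (hM : ∀ n, ∫ x in U, f n x ≤ M) :
    ∃ s : ℕ → ℕ, StrictMono s ∧ ∃ a : SignedMeasure E3, WeakStarTendsto U (fun n => f (s n)) a := by
  let m : ℕ → ℝ := fun n => ∫ x in U, f n x
  let D : ℕ → E3 → ℝ≥0∞ := fun n x => ENNReal.ofReal ((m n)⁻¹ * f n x)
  have hD : ∀ n, AEMeasurable (D n) (volume.restrict U) := fun n =>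
    ((hf n).const_mul _).1.aemeasurable.ennreal_ofReal
  have hD0 : ∀ n, ∀ x ∈ U, 0 ≤ (m n)⁻¹ * f n x := fun n x hx =>
    mul_nonneg (inv_nonneg.2 (hpos n).le) (hf0 n x hx)
  have hprob : ∀ n, IsProbabilityMeasure ((volume.restrict U).withDensity (D n)) := fun n => by
    constructor
    rw [withDensity_apply _ MeasurableSet.univ, Measure.restrict_univ,
      ← ofReal_integral_eq_lintegral_ofReal ((hf n).const_mul _)
        ((ae_restrict_iff' hU.measurableSet).2 (Eventually.of_forall (hD0 n))),
      integral_const_mul, inv_mul_cancel₀ (hpos n).ne', ENNReal.ofReal_one]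
  let P : ℕ → ProbabilityMeasure E3 := fun n => ⟨(volume.restrict U).withDensity (D n), hprob n⟩
  have hPint : ∀ n (φ : E3 → ℝ), m n * ∫ x, U.indicator φ x ∂(P n : Measure E3) =
      ∫ x in U, φ x * f n x := by
    intro n φ
    change m n * ∫ x, U.indicator φ x ∂((volume.restrict U).withDensity (D n)) = _
    rw [integral_withDensity_eq_integral_toReal_smul₀ (hD n) (by simp [D]),
      ← integral_const_mul]
    apply setIntegral_congr_fun hU.measurableSet
    intro x hx
    have := (hpos n).ne'
    simp only [D, ENNReal.toReal_ofReal (hD0 n x hx), smul_eq_mul, indicator_of_mem hx, m]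
    field_simp
  have hcl : IsCompact (closure U) := hUb.isCompact_closure
  have hcomp := (isCompact_Icc (a := (0 : ℝ)) (b := M)).prod
    (isCompact_setOfPred_probabilityMeasure_mass_eq_compl_isCompact_le (E := E3)
      (u := fun _ => 0) (K := fun _ => closure U) tendsto_const_nhds (fun _ => hcl)
      (Or.inr monotone_const))
  obtain ⟨⟨m₀, P₀⟩, ⟨⟨hm₀, -⟩, -⟩, s, hs, hlim⟩ := hcomp.tendsto_subseq (x := fun n => (m n, P n))
    (fun n => ⟨⟨(hpos n).le, hM n⟩, fun _ => by
      have : (P n : Measure E3) (closure U)ᶜ = 0 :=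
        withDensity_absolutelyContinuous _ _ (by
          rw [Measure.restrict_apply hcl.isClosed.measurableSet.compl]
          have : (closure U)ᶜ ∩ U = ∅ := by
            ext x
            simp only [mem_inter_iff, mem_compl_iff, mem_empty_iff_false, iff_false, not_and]
            exact fun h1 h2 => h1 (subset_closure h2)
          rw [this, measure_empty])
      exact le_of_eq ((ProbabilityMeasure.null_iff_toMeasure_null _ _).2 this)⟩)
  have hm : Tendsto (fun n => m (s n)) atTop (𝓝 m₀) := (continuous_fst.tendsto _).comp hlim
  have hP : Tendsto (fun n => P (s n)) atTop (𝓝 P₀) := (continuous_snd.tendsto _).comp hlim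
  refine ⟨s, hs, (m₀.toNNReal • (P₀ : Measure E3)).toSignedMeasure, fun n => hf _, fun φ hφ => ?_⟩
  -- functions of `C₀(U)` extend by zero to bounded continuous functions
  have hφc : Continuous (U.indicator φ) := continuous_indicator hφ.2 hφ.1
  have hφs : HasCompactSupport (U.indicator φ) :=
    HasCompactSupport.intro hcl fun x hx => indicator_of_notMem (fun h => hx (subset_closure h)) _
  obtain ⟨C, hC⟩ := hφs.exists_bound_of_continuous hφc
  have h1 := ProbabilityMeasure.tendsto_iff_forall_integral_tendsto.1 hP
    (BoundedContinuousFunction.ofNormedAddCommGroup _ hφc C hC)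
  have h2 := hm.mul h1
  simp only [BoundedContinuousFunction.coe_ofNormedAddCommGroup, hPint] at h2
  rw [signedIntegral_toSignedMeasure, Measure.restrict_smul, integral_smul_nnreal_measure,
    ← integral_indicator hU.measurableSet, NNReal.smul_def, Real.coe_toNNReal _ hm₀, smul_eq_mul]
  exact h2

theorem le_of_forall_le_comp_add {f : ℝ → ℝ} (hf : Continuous f) {a b : ℝ}
    (h : ∀ e, 0 < e → a ≤ f (b + e)) : a ≤ f b := by
  have h1 : Tendsto (fun e => f (b + e)) (𝓝[>] 0) (𝓝 (f (b + 0))) :=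
    (Continuous.tendsto (by fun_prop) 0).mono_left nhdsWithin_le_nhds
  rw [add_zero] at h1
  exact ge_of_tendsto h1 (by filter_upwards [self_mem_nhdsWithin] with e he using h e he)

namespace IsCoefficientFamily

variable {Ω : Set E3} {α : ℕ → E3 → ℝ} {ε c : ℕ → ℝ} {A M : ℝ}

/-- Weak-* limits of the coefficients are bounded functions. -/
theorem exists_isLpDensity_top (h : IsCoefficientFamily Ω α ε c A M) {s : ℕ → ℕ}
    (hs : StrictMono s) {a : SignedMeasure E3} (ha : WeakStarTendsto Ω (fun n => α (s n)) a) :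
    ∃ f, IsLpDensity Ω a ⊤ f := by
  have hA := h.const_nonneg
  refine HighContrast.exists_isLpDensity_top h.isOpen h.isBounded (C := 6 * A) (by positivity)
    fun φ hφ => le_of_forall_pos_le_add fun e he => ?_
  -- the estimate of the weights applies to `√|φ|`
  have hr : (fun x => √|φ x|) ∈ compactlySupported Ω :=
    comp_mem_compactlySupported hφ (f := fun t => √|t|) (by fun_prop) (by simp)
  refine le_of_tendsto (ha.2 φ (isC0_of_mem_compactlySupported h.isOpen hφ)).abs ?_
  filter_upwards [hs.tendsto_atTop.eventually (h.eventually_integral_mul_sq_le hr he)] with n hn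
  simp only [Real.sq_sqrt (abs_nonneg _)] at hn
  have e1 : |∫ x in Ω, φ x * α (s n) x| ≤ ∫ x in Ω, α (s n) x * |φ x| := by
    refine (abs_integral_le_integral_abs).trans_eq (setIntegral_congr_fun h.isOpen.measurableSet
      fun x hx => ?_)
    simp only [abs_mul, abs_of_pos (h.pos (s n) hx), mul_comm]
  linarith

theorem memLp_and_integral_sq_le (h : IsCoefficientFamily Ω α ε c A M) (n : ℕ) {ζ : E3 → ℝ}
    (hζ : IntegrableOn ζ Ω) {B : ℝ} (hB0 : 0 ≤ B)
    (hB : ∫⁻ x in Ω, ENNReal.ofReal ((α n x)⁻¹ * |ζ x| ^ 2) ≤ ENNReal.ofReal B) :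
    MemLp (fun x => (√(α n x))⁻¹ * ζ x) 2 (volume.restrict Ω) ∧
      ∫ x in Ω, ((√(α n x))⁻¹ * ζ x) ^ 2 ≤ B := by
  have hm : AEStronglyMeasurable (fun x => (√(α n x))⁻¹ * ζ x) (volume.restrict Ω) :=
    (h.measurable n).sqrt.inv.aestronglyMeasurable.mul hζ.1
  have e : ∀ x ∈ Ω, ((√(α n x))⁻¹ * ζ x) ^ 2 = (α n x)⁻¹ * |ζ x| ^ 2 := fun x hx => by
    rw [mul_pow, inv_pow, Real.sq_sqrt (h.pos n hx).le, sq_abs]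
  have hlint : ∫⁻ x in Ω, ENNReal.ofReal (((√(α n x))⁻¹ * ζ x) ^ 2) ≤ ENNReal.ofReal B := by
    refine le_of_eq_of_le (setLIntegral_congr_fun h.isOpen.measurableSet fun x hx => ?_) hB
    simp only [e x hx]
  have hi : Integrable (fun x => ((√(α n x))⁻¹ * ζ x) ^ 2) (volume.restrict Ω) := by
    refine ⟨hm.pow 2, ?_⟩
    rw [hasFiniteIntegral_iff_ofReal (Eventually.of_forall fun x => sq_nonneg _)]
    exact hlint.trans_lt ENNReal.ofReal_lt_top
  refine ⟨(memLp_two_iff_integrable_sq hm).2 hi, ?_⟩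
  rw [← ofReal_integral_eq_lintegral_ofReal hi (Eventually.of_forall fun x => sq_nonneg _)] at hlint
  exact (ENNReal.ofReal_le_ofReal_iff hB0).1 hlint

/-- The Cauchy–Schwarz inequality with the weights `αₙ⁻¹` and `αₙ`. -/
theorem abs_integral_mul_le (h : IsCoefficientFamily Ω α ε c A M) (n : ℕ) {ζ f : E3 → ℝ}
    (hζ : IntegrableOn ζ Ω) {B : ℝ} (hB0 : 0 ≤ B)
    (hB : ∫⁻ x in Ω, ENNReal.ofReal ((α n x)⁻¹ * |ζ x| ^ 2) ≤ ENNReal.ofReal B)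
    (hf : MemLp f 2 (volume.restrict Ω)) :
    |∫ x in Ω, ζ x * f x| ≤ √B * √(∫ x in Ω, α n x * f x ^ 2) := by
  obtain ⟨hm, hle⟩ := h.memLp_and_integral_sq_le n hζ hB0 hB
  have e : ∀ x ∈ Ω, (√(α n x) * f x) ^ 2 = α n x * f x ^ 2 := fun x hx => by
    rw [mul_pow, Real.sq_sqrt (h.pos n hx).le]
  have hm2 : MemLp (fun x => √(α n x) * f x) 2 (volume.restrict Ω) := by
    refine (memLp_two_iff_integrable_sq (f := fun x => √(α n x) * f x)
      ((h.measurable n).sqrt.aestronglyMeasurable.mul hf.1)).2 ?_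
    exact (integrableOn_congr_fun e h.isOpen.measurableSet).2 (h.integrable_mul_sq n hf)
  have e1 : ∫ x in Ω, ζ x * f x = ∫ x in Ω, ((√(α n x))⁻¹ * ζ x) * (√(α n x) * f x) := by
    refine setIntegral_congr_fun h.isOpen.measurableSet fun x hx => ?_
    have := (Real.sqrt_pos.2 (h.pos n hx)).ne'
    field_simp
  rw [e1, ← setIntegral_congr_fun h.isOpen.measurableSet e]
  refine (HighContrast.abs_integral_mul_le hm hm2).trans ?_
  gcongr

theorem memLp_of_lintegral_le (h : IsCoefficientFamily Ω α ε c A M) (n : ℕ) {ζ : E3 → ℝ}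
    (hζ : IntegrableOn ζ Ω) {B : ℝ} (hB0 : 0 ≤ B)
    (hB : ∫⁻ x in Ω, ENNReal.ofReal ((α n x)⁻¹ * |ζ x| ^ 2) ≤ ENNReal.ofReal B) :
    MemLp ζ 2 (volume.restrict Ω) := by
  obtain ⟨L, hL⟩ := h.upper n
  refine (h.memLp_and_integral_sq_le n hζ hB0 hB).1.of_le_mul (c := √L) hζ.1 ?_
  filter_upwards [ae_restrict_mem h.isOpen.measurableSet] with x hx
  have hα := Real.sqrt_pos.2 (h.pos n hx)
  calc ‖ζ x‖ = √(α n x) * ‖(√(α n x))⁻¹ * ζ x‖ := by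
        rw [norm_mul, norm_inv, Real.norm_of_nonneg hα.le]
        field_simp
    _ ≤ √L * ‖(√(α n x))⁻¹ * ζ x‖ := by
        gcongr
        exact hL x hx

/-- Weak-* limits of sequences `ξₙ` with `∫ αₙ⁻¹ |ξₙ|²` bounded are functions of `L²(Ω)`. -/
theorem exists_isLpDensity_two (h : IsCoefficientFamily Ω α ε c A M) {ξs : ℕ → E3 → ℝ}
    {ξ : SignedMeasure E3} (hξ : WeakStarTendsto Ω ξs ξ) {B : ℝ} (hB0 : 0 ≤ B)
    (hB : ∀ n, ∫⁻ x in Ω, ENNReal.ofReal ((α n x)⁻¹ * |ξs n x| ^ 2) ≤ ENNReal.ofReal B) :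
    ∃ g, IsLpDensity Ω ξ 2 g ∧
      ∀ φ ∈ compactlySupported Ω, signedIntegral Ω ξ φ = ∫ x in Ω, φ x * g x := by
  have hA := h.const_nonneg
  refine HighContrast.exists_isLpDensity_two h.isOpen h.isBounded (C := √B * √(6 * A))
    fun φ hφ => ?_
  rw [mul_assoc, ← Real.sqrt_mul (by positivity), mul_assoc]
  refine le_of_forall_le_comp_add (f := fun t => √B * √t) (by fun_prop) fun e he => ?_
  refine le_of_tendsto (hξ.2 φ (isC0_of_mem_compactlySupported h.isOpen hφ)).abs ?_
  filter_upwards [h.eventually_integral_mul_sq_le hφ he] with n hn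
  simp only [mul_comm (φ _)]
  refine (h.abs_integral_mul_le n (hξ.1 n) hB0 (hB n)
    (memLp_of_mem_compactlySupported hφ 2 Ω)).trans ?_
  gcongr

/-- Convergence in the sense of distributions of the products `ξₙ vₙ`. For a test function `φ`, the
limit `v` is replaced by a test function `ψ` close to it in `L²(Ω)`; the error is controlled by
`∫ αₙ |vₙ - ψ|²` on the support of `φ`, and `∫ ξₙ ψ φ` converges by hypothesis. -/
theorem tendstoDistribution_mul (h : IsCoefficientFamily Ω α ε c A M) {ξs : ℕ → E3 → ℝ}
    {ξ : SignedMeasure E3} (hξ : WeakStarTendsto Ω ξs ξ) {B : ℝ} (hB0 : 0 ≤ B)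
    (hB : ∀ n, ∫⁻ x in Ω, ENNReal.ofReal ((α n x)⁻¹ * |ξs n x| ^ 2) ≤ ENNReal.ofReal B)
    {g : E3 → ℝ} (hg : MemLp g 2 (volume.restrict Ω))
    (hξg : ∀ φ ∈ compactlySupported Ω, signedIntegral Ω ξ φ = ∫ x in Ω, φ x * g x)
    {vs : ℕ → E3 → ℝ} {Gs : ℕ → E3 → E3} {v : E3 → ℝ} {G : E3 → E3}
    (hv : WeakTendstoH1 Ω vs Gs v G) (hGB : ∀ n, ∫ x in Ω, α n x * ‖Gs n x‖ ^ 2 ≤ B) :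
    TendstoDistribution Ω (fun n x => ξs n x * vs n x) (fun x => g x * v x) := by
  have hA := h.const_nonneg
  have hξ2 := fun n => h.memLp_of_lintegral_le n (hξ.1 n) hB0 (hB n)
  refine ⟨fun n => IntegrableOn.locallyIntegrableOn
    (integrable_mul_of_memLp_two (hξ2 n) (hv.1 n).1), IntegrableOn.locallyIntegrableOn
    (integrable_mul_of_memLp_two hg hv.2.1.1), fun φ hφ => ?_⟩
  have hφC := hφ.mem_compactlySupported
  obtain ⟨C, hC⟩ := hφ.2.1.exists_bound_of_continuous hφ.1.continuous
  have hC0 : 0 ≤ C := (norm_nonneg _).trans (hC 0)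
  have hbm : ∀ {f : E3 → ℝ}, MemLp f 2 (volume.restrict Ω) →
      MemLp (fun x => f x * φ x) 2 (volume.restrict Ω) := fun hf =>
    hf.of_le_mul (c := C) (hf.1.mul hφ.1.continuous.aestronglyMeasurable)
      (Eventually.of_forall fun x => by
        rw [norm_mul, mul_comm]
        gcongr
        exact hC x)
  rw [Metric.tendsto_atTop]
  intro e he
  -- `τ` bounds both `∫ |v - ψ|²` and the error in the asymptotic estimate of the weighted energy
  obtain ⟨τ, hτ0, hτ⟩ : ∃ τ : ℝ, 0 < τ ∧
      √B * (C * √(6 * (A * τ) + τ)) + √(∫ x in Ω, g x ^ 2) * (C * √τ) < e / 2 := by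
    have h1 : Tendsto (fun τ : ℝ =>
        √B * (C * √(6 * (A * τ) + τ)) + √(∫ x in Ω, g x ^ 2) * (C * √τ)) (𝓝[>] 0)
        (𝓝 (√B * (C * √(6 * (A * 0) + 0)) + √(∫ x in Ω, g x ^ 2) * (C * √0))) :=
      (Continuous.tendsto (by fun_prop) 0).mono_left nhdsWithin_le_nhds
    have h2 := h1.eventually_lt_const (u := e / 2) (by simpa using by positivity)
    obtain ⟨τ, h3, h4⟩ := (h2.and self_mem_nhdsWithin).exists
    exact ⟨τ, h4, h3⟩
  obtain ⟨ψ, hψ, hvψ⟩ := exists_testFunction_integral_sub_sq_lt h.isOpen hv.2.1.1 hτ0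
  have hψC := hψ.mem_compactlySupported
  have hψ2 := hψ.memLp 2 Ω
  have hlim := hξ.2 _ (isC0_of_mem_compactlySupported h.isOpen
    (mul_mem_compactlySupported hψC hφ.1.continuous))
  rw [hξg _ (mul_mem_compactlySupported hψC hφ.1.continuous)] at hlim
  have hK := h.eventually_setIntegral_mul_sub_sq_le hv.1 hGB hv.2.1.1
    (fun K hK hKΩ => hv.tendsto_integral_sub_sq h.isOpen h.isBounded hK hKΩ) hψC hφ.2.1 hφ.2.2 hτ0
  obtain ⟨N, hN⟩ := eventually_atTop.1 (hK.and (Metric.tendsto_nhds.1 hlim (e / 2) (by positivity)))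
  refine ⟨N, fun n hn => ?_⟩
  obtain ⟨hn1, hn2⟩ := hN n hn
  have m1 : MemLp (fun x => vs n x - ψ x) 2 (volume.restrict Ω) := (hv.1 n).1.sub hψ2
  have m2 : MemLp (fun x => ψ x - v x) 2 (volume.restrict Ω) := hψ2.sub hv.2.1.1
  have b1 : |∫ x in Ω, ξs n x * ((vs n x - ψ x) * φ x)| ≤ √B * (C * √(6 * (A * τ) + τ)) := by
    refine (h.abs_integral_mul_le n (hξ.1 n) hB0 (hB n) (hbm m1)).trans ?_
    gcongr
    rw [← Real.sqrt_sq hC0, ← Real.sqrt_mul (by positivity)]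
    apply Real.sqrt_le_sqrt
    have i1 := h.integrable_mul_sq n (hbm m1)
    have i2 := h.integrable_mul_sq n m1
    calc ∫ x in Ω, α n x * ((vs n x - ψ x) * φ x) ^ 2
        = ∫ x in tsupport φ, α n x * ((vs n x - ψ x) * φ x) ^ 2 := by
          rw [setIntegral_eq_integral_of_forall_compl_eq_zero (s := Ω) fun x hx => by
              rw [hφ.eq_zero_of_notMem hx]; simp,
            setIntegral_eq_integral_of_forall_compl_eq_zero fun x hx => by
              rw [image_eq_zero_of_notMem_tsupport hx]; simp]
      _ ≤ ∫ x in tsupport φ, C ^ 2 * (α n x * (vs n x - ψ x) ^ 2) := by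
          refine setIntegral_mono_on (i1.mono_set hφ.2.2) ((i2.mono_set hφ.2.2).const_mul _)
            (isClosed_tsupport φ).measurableSet fun x hx => ?_
          have h1 : φ x ^ 2 ≤ C ^ 2 := by
            rw [← sq_abs]
            exact pow_le_pow_left₀ (abs_nonneg _) (hC x) 2
          have h2 : 0 ≤ α n x * (vs n x - ψ x) ^ 2 :=
            mul_nonneg (h.pos n (hφ.2.2 hx)).le (sq_nonneg _)
          calc _ = φ x ^ 2 * (α n x * (vs n x - ψ x) ^ 2) := by ring
            _ ≤ _ := by gcongr
      _ ≤ C ^ 2 * (6 * (A * τ) + τ) := by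
          rw [integral_const_mul]
          gcongr
          refine hn1.trans ?_
          gcongr
  have b2 : |∫ x in Ω, g x * ((ψ x - v x) * φ x)| ≤ √(∫ x in Ω, g x ^ 2) * (C * √τ) := by
    refine (HighContrast.abs_integral_mul_le hg (hbm m2)).trans ?_
    gcongr
    rw [← Real.sqrt_sq hC0, ← Real.sqrt_mul (by positivity)]
    apply Real.sqrt_le_sqrt
    calc ∫ x in Ω, ((ψ x - v x) * φ x) ^ 2 ≤ ∫ x in Ω, C ^ 2 * (v x - ψ x) ^ 2 := by
          refine integral_mono (hbm m2).integrable_sq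
            ((hv.2.1.1.sub hψ2).integrable_sq.const_mul _) fun x => ?_
          have h1 : φ x ^ 2 ≤ C ^ 2 := by
            rw [← sq_abs]
            exact pow_le_pow_left₀ (abs_nonneg _) (hC x) 2
          calc ((ψ x - v x) * φ x) ^ 2 = φ x ^ 2 * (v x - ψ x) ^ 2 := by ring
            _ ≤ _ := by gcongr
      _ ≤ C ^ 2 * τ := by
          rw [integral_const_mul]
          gcongr
  have j1 := integrable_mul_of_memLp_two (hξ2 n) (hbm m1)
  have j2 := integrable_mul_of_memLp_two (hξ2 n) (hbm hψ2)
  have j3 := integrable_mul_of_memLp_two hg (hbm m2)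
  have j4 := integrable_mul_of_memLp_two hg (hbm hv.2.1.1)
  have e1 : ∫ x in Ω, ξs n x * vs n x * φ x = (∫ x in Ω, ξs n x * ((vs n x - ψ x) * φ x)) +
      ∫ x in Ω, ψ x * φ x * ξs n x := by
    have : ∀ x, ψ x * φ x * ξs n x = ξs n x * (ψ x * φ x) := fun x => mul_comm _ _
    simp only [this]
    rw [← integral_add j1 j2]
    congr 1; ext x; ring
  have e2 : ∫ x in Ω, ψ x * φ x * g x = (∫ x in Ω, g x * ((ψ x - v x) * φ x)) +
      ∫ x in Ω, g x * v x * φ x := by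
    have : ∀ x, g x * v x * φ x = g x * (v x * φ x) := fun x => mul_assoc _ _ _
    simp only [this]
    rw [← integral_add j3 j4]
    congr 1; ext x; ring
  rw [Real.dist_eq] at hn2 ⊢
  rw [e1]
  rw [e2] at hn2
  calc |(∫ x in Ω, ξs n x * ((vs n x - ψ x) * φ x)) + (∫ x in Ω, ψ x * φ x * ξs n x) -
        ∫ x in Ω, g x * v x * φ x|
      = |(∫ x in Ω, ξs n x * ((vs n x - ψ x) * φ x)) + ((∫ x in Ω, ψ x * φ x * ξs n x) -
        ((∫ x in Ω, g x * ((ψ x - v x) * φ x)) + ∫ x in Ω, g x * v x * φ x)) +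
        ∫ x in Ω, g x * ((ψ x - v x) * φ x)| := by congr 1; ring
    _ ≤ _ := abs_add_three _ _ _
    _ < e := by linarith

end IsCoefficientFamily

end HighContrast

namespace HighContrast

/-! ### Two-phase coefficients -/

theorem twoPhase_of_mem {Ω D : Set E3} {a₁ a₂ : ℝ} {x : E3} (hx : x ∈ D) :
    twoPhase Ω D a₁ a₂ x = a₂ := by
  simp [twoPhase, hx]

theorem twoPhase_of_notMem {Ω D : Set E3} {a₁ a₂ : ℝ} {x : E3} (hxΩ : x ∈ Ω) (hx : x ∉ D) :
    twoPhase Ω D a₁ a₂ x = a₁ := by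
  simp [twoPhase, hx, hxΩ]

theorem setIntegral_twoPhase_le {Ω D : Set E3} (hΩ : MeasurableSet Ω) (hΩF : volume Ω ≠ ⊤)
    (hΩ0 : 0 < volume.real Ω) (hD : MeasurableSet D) (hDΩ : D ⊆ Ω) {a₁ a₂ : ℝ} (ha₁ : 0 ≤ a₁) :
    ∫ x in Ω, twoPhase Ω D a₁ a₂ x ≤
      volume.real Ω * (a₁ + volumeFraction Ω D * a₂) := by
  have hF : IsFiniteMeasure (volume.restrict Ω : Measure E3) := ⟨by simpa using hΩF.lt_top⟩
  simp only [twoPhase]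
  rw [integral_add ((integrable_const a₁).indicator (hΩ.diff hD))
      ((integrable_const a₂).indicator hD), integral_indicator (hΩ.diff hD),
    integral_indicator hD, Measure.restrict_restrict (hΩ.diff hD), Measure.restrict_restrict hD,
    inter_eq_left.2 sdiff_subset, inter_eq_left.2 hDΩ, setIntegral_const, setIntegral_const,
    smul_eq_mul, smul_eq_mul, mul_add]
  have h1 : volume.real (Ω \ D) ≤ volume.real Ω := measureReal_mono sdiff_subset hΩF
  have h2 : volume.real Ω * (volumeFraction Ω D * a₂) = volume.real D * a₂ := by
    rw [volumeFraction]
    field_simp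
  rw [h2]
  gcongr

end HighContrast
theorem mainTheorem3
    -- the domain and the highly conducting phases
    (Ω : Set HighContrast.E3) (hΩ_open : IsOpen Ω) (hΩ_bdd : Bornology.IsBounded Ω)
    (Ωs : ℕ → Set HighContrast.E3) (hΩs_meas : ∀ n, MeasurableSet (Ωs n)) (hΩs : ∀ n, Ωs n ⊆ Ω)
    -- the conductivities
    (α₁ α₂ : ℝ) (hα₁ : 0 < α₁) (hα₂ : 0 < α₂)
    (α₂s : ℕ → ℝ) (hα₂s : ∀ n, α₁ ≤ α₂s n)
    (hθ : Tendsto (fun n => HighContrast.volumeFraction Ω (Ωs n) * α₂s n) atTop (𝓝 α₂))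
    (α : ℕ → HighContrast.E3 → ℝ)
    (hα : ∀ n, α n = HighContrast.twoPhase Ω (Ωs n) α₁ (α₂s n))
    -- the size of the cells
    (ε : ℕ → ℝ) (hε_pos : ∀ n, 0 < ε n) (hε : Tendsto ε atTop (𝓝 0))
    -- weighted Poincaré-Wirtinger inequality in the cells
    (c : ℕ → ℝ) (hc_pos : ∀ n, 0 < c n) (hc : Tendsto c atTop (𝓝 0))
    (hPW : ∀ n (k : Fin 3 → ℤ), HighContrast.cell (ε n) k ⊆ Ω →
      HighContrast.WeightedPoincareWirtinger (HighContrast.cell (ε n) k) (α n) (c n))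
    -- bounded averages in the cells
    (A : ℝ) (hA : ∀ n (k : Fin 3 → ℤ), HighContrast.cell (ε n) k ⊆ Ω →
      ⨍ x in HighContrast.cell (ε n) k, α n x ≤ A)
    -- the two sequences
    (ξs : ℕ → HighContrast.E3 → ℝ) (ξ : SignedMeasure HighContrast.E3)
    (hξ : HighContrast.WeakStarTendsto Ω ξs ξ)
    (vs : ℕ → HighContrast.E3 → ℝ) (Gs : ℕ → HighContrast.E3 → HighContrast.E3)
    (v : HighContrast.E3 → ℝ) (G : HighContrast.E3 → HighContrast.E3)
    (hv : HighContrast.WeakTendstoH1 Ω vs Gs v G)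
    (B : ℝ) (hB : ∀ n,
      (∫⁻ x in Ω, ENNReal.ofReal ((α n x)⁻¹ * |ξs n x| ^ 2)) +
        (∫⁻ x in Ω, ENNReal.ofReal (α n x * ‖Gs n x‖ ^ 2)) ≤ ENNReal.ofReal B) :
    -- `ξ` is a function of `L²(Ω)` and `ξₙ vₙ → ξ v` in the sense of distributions
    (∃ g : HighContrast.E3 → ℝ, HighContrast.IsLpDensity Ω ξ 2 g ∧
      HighContrast.TendstoDistribution Ω (fun n x => ξs n x * vs n x) (fun x => g x * v x)) ∧
    -- a subsequence of `αₙ` converges weakly-*, and every such limit is a function of `L^∞(Ω)`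
    (∃ s : ℕ → ℕ, StrictMono s ∧ ∃ a : SignedMeasure HighContrast.E3,
      HighContrast.WeakStarTendsto Ω (fun n => α (s n)) a) ∧
    (∀ s : ℕ → ℕ, StrictMono s → ∀ a : SignedMeasure HighContrast.E3,
      HighContrast.WeakStarTendsto Ω (fun n => α (s n)) a →
        ∃ f : HighContrast.E3 → ℝ, HighContrast.IsLpDensity Ω a ∞ f) := by
  have hΩm := hΩ_open.measurableSet
  have hΩF : volume Ω ≠ ⊤ := hΩ_bdd.measure_lt_top.ne
  -- `Ω` is not empty, as otherwise all volume fractions are `0 / 0 = 0` and `α₂ = 0`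
  have hΩne : Ω.Nonempty := by
    rw [nonempty_iff_ne_empty]
    rintro rfl
    have h0 : Tendsto (fun n => HighContrast.volumeFraction ∅ (Ωs n) * α₂s n) atTop (𝓝 0) := by
      simp [HighContrast.volumeFraction]
    exact hα₂.ne' (tendsto_nhds_unique hθ h0)
  have hΩ0 : 0 < volume.real Ω :=
    ENNReal.toReal_pos (hΩ_open.measure_pos volume hΩne).ne' hΩF
  have hval : ∀ n, ∀ x ∈ Ω, α₁ ≤ α n x ∧ α n x ≤ α₂s n := by
    intro n x hx
    rw [hα n]
    by_cases h : x ∈ Ωs n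
    · rw [HighContrast.twoPhase_of_mem h]
      exact ⟨hα₂s n, le_rfl⟩
    · rw [HighContrast.twoPhase_of_notMem hx h]
      exact ⟨le_rfl, hα₂s n⟩
  obtain ⟨T, hT⟩ := hθ.bddAbove_range
  have hmass : ∀ n, ∫ x in Ω, α n x ≤ volume.real Ω * (α₁ + T) := by
    intro n
    rw [hα n]
    refine (HighContrast.setIntegral_twoPhase_le hΩm hΩF hΩ0 (hΩs_meas n) (hΩs n) hα₁.le).trans ?_
    gcongr
    exact hT ⟨n, rfl⟩
  -- the constants `A` and `B`, whose sign is not prescribed, are replaced by `max A 0`, `max B 0`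
  have h : HighContrast.IsCoefficientFamily Ω α ε c (max A 0) (volume.real Ω * (α₁ + T)) :=
    { isOpen := hΩ_open
      isBounded := hΩ_bdd
      measurable := fun n => by
        rw [hα n]
        exact (measurable_const.indicator (hΩm.diff (hΩs_meas n))).add
          (measurable_const.indicator (hΩs_meas n))
      pos := fun n x hx => hα₁.trans_le (hval n x hx).1
      upper := fun n => ⟨α₂s n, fun x hx => (hval n x hx).2⟩
      integral_le := hmass
      eps_pos := hε_pos
      eps_tendsto := hε
      c_pos := hc_pos
      c_tendsto := hc
      poincare := hPW
      average_le := fun n k hk => (hA n k hk).trans (le_max_left _ _)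
      const_nonneg := le_max_right _ _ }
  have hB0 : 0 ≤ max B 0 := le_max_right _ _
  have hBmax : ENNReal.ofReal B ≤ ENNReal.ofReal (max B 0) :=
    ENNReal.ofReal_le_ofReal (le_max_left _ _)
  have hξB := fun n => (le_self_add.trans (hB n)).trans hBmax
  have hGB : ∀ n, ∫ x in Ω, α n x * ‖Gs n x‖ ^ 2 ≤ max B 0 := by
    intro n
    have h1 := (le_add_self.trans (hB n)).trans hBmax
    rw [← ofReal_integral_eq_lintegral_ofReal (h.integrable_mul_norm_sq n (hv.1 n).2.1)
      ((ae_restrict_iff' hΩm).2 (Eventually.of_forall fun x hx =>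
        mul_nonneg (h.pos n hx).le (sq_nonneg _)))] at h1
    exact (ENNReal.ofReal_le_ofReal_iff hB0).1 h1
  obtain ⟨g, hg, hgφ⟩ := h.exists_isLpDensity_two hξ hB0 hξB
  have hpos : ∀ n, 0 < ∫ x in Ω, α n x := fun n => by
    have h1 : ∫ _ in Ω, α₁ ≤ ∫ x in Ω, α n x :=
      setIntegral_mono_on (integrableOn_const hΩF) (h.integrable n) hΩm fun x hx => (hval n x hx).1
    rw [setIntegral_const, smul_eq_mul] at h1
    exact (mul_pos hΩ0 hα₁).trans_le h1
  exact ⟨⟨g, hg, h.tendstoDistribution_mul hξ hB0 hξB hg.1 hgφ hv hGB⟩,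
    HighContrast.exists_weakStarTendsto_subseq hΩ_open hΩ_bdd h.integrable
      (fun n x hx => (h.pos n hx).le) hpos hmass,
    fun s hs a ha => h.exists_isLpDensity_top hs ha⟩
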